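/- Let $\ell$ be a prime number, $n\ge 1$ an integer, and $F$ a field of characteristic different from $\ell$ that has no nontrivial finite extensions of degree prime to $\ell$. For a field $K$ write $k_m(K)=K^{\mathrm M}_m(K)/\ell K^{\mathrm M}_m(K)$ for the Milnor K-groups of $K$ modulo $\ell$, and for an extension $L/K$ let $i\colon k_m(K)\to k_m(L)$ be the map induced by the inclusion. If $K$ is a finite extension of $F$ and $[L:K]=\ell$, let $\mathrm{tr}_{L/K}\colon k_m(L)\to k_m(K)$ be the (Bass--Tate) transfer homomorphism, i.e. the unique homomorphism with $\mathrm{tr}_{L/K}(i(x))=[L:K]\,x$ for $x\in k_m(K)$ and $\mathrm{tr}_{L/K}\{a_1,\dots,b,\dots,a_m\}=\{a_1,\dots,N_{L/K}(b),\dots,a_m\}$ for $b\in L^\times$ in any one position and all other entries $a_j\in K^\times$. It factors through the group $k_m(L)_\Sigma$ of coinvariants of $\Sigma=\mathrm{Gal}(L/K)$. Assume that for all finite extensions $F\subset K\subset L$ with $[L:K]=\ell$ the sequence $$k_n(K)\xrightarrow{\;i\;}k_n(L)_\Sigma\xrightarrow{\;\mathrm{tr}\;}k_n(K),\qquad \Sigma=\mathrm{Gal}(L/K),$$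 is exact (in the middle term). Let $E/F$ be an extension with $[E:F]=\ell$ such that $\mathrm{tr}_{E/F}\colon k_n(E)\to k_n(F)$ is surjective. Then the sequence $$k_{n+1}(F)\xrightarrow{\;i\;}k_{n+1}(E)_\Sigma\xrightarrow{\;\mathrm{tr}\;}k_{n+1}(F),\qquad \Sigma=\mathrm{Gal}(E/F),$$ is also exact (in the middle term). -/

import Mathlib

open scoped TensorProduct

universe u

noncomputable section

/-! ### Milnor K-theory of fields -/

/-- The degree `n` part of the two-sided ideal generated by the tensors `a ⊗ (1 - a)` in the tensor
algebra of the abelian group `Fˣ`: it is spanned by the `a₁ ⊗ ⋯ ⊗ aₙ` for which `aᵢ + aᵢ₊₁ = 1`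
for some `i`. -/
def steinbergRelations (F : Type*) [Field F] (n : ℕ) :
    Submodule ℤ (⨂[ℤ] _ : Fin n, Additive Fˣ) :=
  Submodule.span ℤ {x | ∃ (a : Fin n → Fˣ) (i j : Fin n), (j : ℕ) = (i : ℕ) + 1 ∧
    (a i : F) + (a j : F) = 1 ∧ x = PiTensorProduct.tprod ℤ (fun k => Additive.ofMul (a k))}

/-- The Milnor K-group `Kₙᴹ(F)`. -/
def MilnorK (F : Type*) [Field F] (n : ℕ) : Type _ :=
  (⨂[ℤ] _ : Fin n, Additive Fˣ) ⧸ steinbergRelations F n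

instance (F : Type*) [Field F] (n : ℕ) : AddCommGroup (MilnorK F n) :=
  inferInstanceAs (AddCommGroup ((⨂[ℤ] _ : Fin n, Additive Fˣ) ⧸ steinbergRelations F n))

/-- The Milnor K-group modulo `ℓ`, `kₙ(F) = Kₙᴹ(F) / ℓ Kₙᴹ(F)`. -/
abbrev MilnorKMod (ℓ : ℕ) (F : Type*) [Field F] (n : ℕ) : Type _ := ModN (MilnorK F n) ℓ

namespace MilnorK

/-- The symbol `{a₁, …, aₙ}` in `Kₙᴹ(F)`. -/
def symbol {F : Type*} [Field F] {n : ℕ} (a : Fin n → Fˣ) : MilnorK F n :=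
  (steinbergRelations F n).mkQ (PiTensorProduct.tprod ℤ (fun k => Additive.ofMul (a k)))

/-- Additive maps out of `Kₙᴹ(F)` are determined by their values on symbols. -/
theorem hom_ext {F : Type*} [Field F] {n : ℕ} {A : Type*} [AddCommGroup A]
    {f g : MilnorK F n →+ A} (h : ∀ a : Fin n → Fˣ, f (symbol a) = g (symbol a)) : f = g := by
  let q : (⨂[ℤ] _ : Fin n, Additive Fˣ) →+ MilnorK F n :=
    (steinbergRelations F n).mkQ.toAddMonoidHom
  have key : (f.comp q).toIntLinearMap = (g.comp q).toIntLinearMap := by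
    apply PiTensorProduct.ext
    ext a
    exact h (fun k => (a k).toMul)
  ext x
  obtain ⟨y, rfl⟩ := (steinbergRelations F n).mkQ_surjective x
  exact DFunLike.congr_fun key y

/-- The map `Kₙᴹ(F) → Kₙᴹ(F')`, `{a₁, …, aₙ} ↦ {φ a₁, …, φ aₙ}`, induced by a homomorphism
of fields `φ : F → F'`. -/
def map {F F' : Type*} [Field F] [Field F'] (φ : F →+* F') (n : ℕ) :
    MilnorK F n →+ MilnorK F' n :=
  (Submodule.mapQ (steinbergRelations F n) (steinbergRelations F' n)
    (PiTensorProduct.map fun _ =>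
      (MonoidHom.toAdditive (Units.map (φ : F →* F'))).toIntLinearMap) (by
    rw [steinbergRelations, Submodule.span_le]
    rintro _ ⟨a, i, j, hij, ha, rfl⟩
    refine Submodule.subset_span ⟨fun k => Units.map (φ : F →* F') (a k), i, j, hij, ?_, ?_⟩
    · simpa using congrArg φ ha
    · rw [PiTensorProduct.map_tprod]
      rfl)).toAddMonoidHom

theorem map_symbol {F F' : Type*} [Field F] [Field F'] (φ : F →+* F') {n : ℕ} (a : Fin n → Fˣ) :
    map φ n (symbol a) = symbol (fun k => Units.map (φ : F →* F') (a k)) := by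
  change (steinbergRelations F' n).mkQ (PiTensorProduct.map _ (PiTensorProduct.tprod ℤ _)) = _
  rw [PiTensorProduct.map_tprod]
  rfl

end MilnorK

namespace MilnorKMod

/-- The symbol `{a₁, …, aₙ}` in `kₙ(F)`. -/
def symbol (ℓ : ℕ) {F : Type*} [Field F] {n : ℕ} (a : Fin n → Fˣ) : MilnorKMod ℓ F n :=
  ModN.mkQ ℓ (MilnorK.symbol a)

/-- Additive maps out of `kₙ(F)` are determined by their values on symbols. -/
theorem hom_ext {ℓ : ℕ} {F : Type*} [Field F] {n : ℕ} {A : Type*} [AddCommGroup A]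
    {f g : MilnorKMod ℓ F n →+ A} (h : ∀ a : Fin n → Fˣ, f (symbol ℓ a) = g (symbol ℓ a)) :
    f = g := by
  have key : f.comp (ModN.mkQ ℓ) = g.comp (ModN.mkQ ℓ) := MilnorK.hom_ext h
  ext x
  obtain ⟨y, rfl⟩ := Submodule.mkQ_surjective _ x
  exact DFunLike.congr_fun key y

/-- The map `kₙ(F) → kₙ(F')` induced by a homomorphism of fields `F → F'`. -/
def map (ℓ : ℕ) {F F' : Type*} [Field F] [Field F'] (φ : F →+* F') (n : ℕ) :
    MilnorKMod ℓ F n →+ MilnorKMod ℓ F' n :=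
  (Submodule.mapQ _ _ (MilnorK.map φ n).toIntLinearMap (by
    rintro _ ⟨x, rfl⟩
    exact ⟨MilnorK.map φ n x, by simp⟩)).toAddMonoidHom

theorem map_symbol (ℓ : ℕ) {F F' : Type*} [Field F] [Field F'] (φ : F →+* F') {n : ℕ}
    (a : Fin n → Fˣ) :
    map ℓ φ n (symbol ℓ a) = symbol ℓ (fun k => Units.map (φ : F →* F') (a k)) :=
  congrArg (ModN.mkQ ℓ) (MilnorK.map_symbol φ a)

variable (ℓ : ℕ) (K L : Type*) [Field K] [Field L] [Algebra K L] (n : ℕ)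

/-- The inclusion homomorphism `i_{L/K} : kₙ(K) → kₙ(L)`. -/
def incl : MilnorKMod ℓ K n →+ MilnorKMod ℓ L n := map ℓ (algebraMap K L) n

/-- The natural action of `Gal(L/K)` on `kₙ(L)`. -/
def galRep : Representation ℤ (L ≃ₐ[K] L) (MilnorKMod ℓ L n) where
  toFun σ := (map ℓ (σ : L →+* L) n).toIntLinearMap
  map_one' := by
    apply LinearMap.toAddMonoidHom_injective
    apply hom_ext
    intro a
    exact map_symbol ℓ _ a
  map_mul' σ τ := by
    apply LinearMap.toAddMonoidHom_injective
    apply hom_ext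
    intro a
    change map ℓ ((σ * τ : L ≃ₐ[K] L) : L →+* L) n (symbol ℓ a) =
      map ℓ (σ : L →+* L) n (map ℓ (τ : L →+* L) n (symbol ℓ a))
    rw [map_symbol, map_symbol, map_symbol]
    rfl

/-- The coinvariants `kₙ(L)_Σ`, where `Σ = Gal(L/K)`. -/
abbrev Coinv : Type _ := (galRep ℓ K L n).Coinvariants

/-- The composition `kₙ(K) → kₙ(L) → kₙ(L)_Σ` of the inclusion with the projection. -/
def inclCoinv : MilnorKMod ℓ K n →+ Coinv ℓ K L n :=
  (Representation.Coinvariants.mk (galRep ℓ K L n)).toAddMonoidHom.comp (incl ℓ K L n)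

/-! ### Transfers -/

variable {ℓ K L n} in
/-- The conditions describing the transfer `tr : kₙ(L) → kₙ(K)`: one has `tr (i x) = [L : K] x`
for `x` in `kₙ(K)`, and `tr {a₁, …, b, …, aₙ} = {a₁, …, N b, …, aₙ}` for `b` in `L` (in any one
position) and all the other entries `aᵢ` in `K`, where `N` is the norm of `L / K`; the latter is the
projection formula together with the fact that the transfer in degree `1` is the norm. -/
structure IsTransfer (f : MilnorKMod ℓ L n →+ MilnorKMod ℓ K n) : Prop where
  map_incl : ∀ x : MilnorKMod ℓ K n, f (incl ℓ K L n x) = Module.finrank K L • x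
  map_symbol_update : ∀ (a : Fin n → Kˣ) (j : Fin n) (b : Lˣ),
    f (symbol ℓ (Function.update (fun k => Units.map (algebraMap K L : K →* L) (a k)) j b)) =
      symbol ℓ (Function.update a j (Units.map (Algebra.norm K : L →* K) b))

variable {ℓ K L n} in
theorem IsTransfer.comp_map {f : MilnorKMod ℓ L n →+ MilnorKMod ℓ K n} (hf : IsTransfer f)
    (σ : L ≃ₐ[K] L) : IsTransfer (f.comp (map ℓ (σ : L →+* L) n)) where
  map_incl x := by
    have h : (map ℓ (σ : L →+* L) n).comp (incl ℓ K L n) = incl ℓ K L n := by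
      apply hom_ext
      intro a
      simp only [AddMonoidHom.comp_apply, incl, map_symbol]
      congr 1
      ext k
      simp
    rw [← hf.map_incl x]
    exact congrArg f (DFunLike.congr_fun h x)
  map_symbol_update a j b := by
    have hb : Units.map (Algebra.norm K : L →* K) (Units.map (σ : L →* L) b) =
        Units.map (Algebra.norm K : L →* K) b := by
      ext
      exact Algebra.norm_eq_of_algEquiv σ (b : L)
    rw [AddMonoidHom.comp_apply, map_symbol, ← hb, ← hf.map_symbol_update]
    congr 2
    ext k
    rcases eq_or_ne k j with rfl | hk
    · simp
    · simp [hk]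

open Classical in
/-- The transfer homomorphism `tr_{L/K} : kₙ(L) → kₙ(K)`, for an extension `L / K` of prime degree
`ℓ` of a field `K` that has no nontrivial finite extensions of degree prime to `ℓ`: the unique
homomorphism with `tr (i x) = [L : K] x` and `tr {a₁, …, b, …, aₙ} = {a₁, …, N b, …, aₙ}`.
By Bass and Tate, for such extensions the transfer exists and has these properties, and
`kₙ(L)` is generated by `i kₙ(K)` and the symbols with at most one entry outside of `K`, so that
they characterize it. (Value `0` if there is no unique such homomorphism.) -/
def transfer : MilnorKMod ℓ L n →+ MilnorKMod ℓ K n :=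
  if h : ∃! f : MilnorKMod ℓ L n →+ MilnorKMod ℓ K n, IsTransfer f then h.choose else 0

theorem transfer_comp_map (σ : L ≃ₐ[K] L) :
    (transfer ℓ K L n).comp (map ℓ (σ : L →+* L) n) = transfer ℓ K L n := by
  unfold transfer
  split_ifs with h
  · exact h.unique (h.choose_spec.1.comp_map σ) h.choose_spec.1
  · rfl

/-- The homomorphism `kₙ(L)_Σ → kₙ(K)` induced by the transfer. -/
def transferCoinv : Coinv ℓ K L n →+ MilnorKMod ℓ K n :=
  (Representation.Coinvariants.lift (galRep ℓ K L n) (transfer ℓ K L n).toIntLinearMap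
    (fun σ => LinearMap.toAddMonoidHom_injective (transfer_comp_map ℓ K L n σ))).toAddMonoidHom

/-- The sequence `kₙ(K) → kₙ(L)_Σ → kₙ(K)` of the inclusion and the transfer, `Σ = Gal(L/K)`, is
exact (in the middle term). -/
def CoinvExact : Prop :=
  Function.Exact (inclCoinv ℓ K L n) (transferCoinv ℓ K L n)

end MilnorKMod

/-- The field `F` has no (nontrivial) finite extensions of degree prime to `ℓ`. -/
def NoPrimeToExtensions (ℓ : ℕ) (F : Type u) [Field F] : Prop :=
  ∀ (K : Type u) [Field K] [Algebra F K] [FiniteDimensional F K],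
    (Module.finrank F K).Coprime ℓ → Module.finrank F K = 1

end

/-! Let C be the cokernel of k_{n+1}(F) → k_{n+1}(E)_Σ. The proof constructs a homomorphism f :
k_{n+1}(F) → C such that f ∘ tr is the projection k_{n+1}(E) → C. An element of transfer zero then
has class zero in C, which is the nontrivial half of exactness.

Put f({c} x) = class of {c} α, where α in k_n(E) has transfer x. Such an α exists by surjectivity,
and its choice does not matter, by exactness for E/F in degree n (`toCoker_mul_eq_zero`). The
Steinberg relation between c and the first entry of x is the real content: if c + a = 1 and tr α =
{a} x, then {c} α must vanish in C. If a is an ℓ-th power in F, then {a} x = 0. If only E contains a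
root β of X^ℓ - a, then c = N(1 - β), and modulo the Galois action {c} α becomes {1 - β} times the
sum of the conjugates of α. That sum is i(tr α) = i({a} x) = 0 (`toCoker_mul_eq_zero_of_root_mem`).
Otherwise adjoin b = a^{1/ℓ} and set K = F(b), M = E(b). Over M the transfer of α to K is {b^ℓ} x =
0, so exactness for M/K says that α comes from K up to Galois differences. Multiplying by {1 - b}
and transferring to E turns α into {c} α, and the element from K into one from F
(`toCoker_mul_eq_zero_of_root_notMem`).

All this needs a genuine transfer, whereas `transfer` is 0 by definition unless a unique
`IsTransfer` map exists. Since polynomials of degree less than ℓ split over K, every unit of L =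
K(θ) is a product of constants and linear polynomials in θ; Steinberg relations between linear
polynomials then leave at most one nonconstant entry, which gives uniqueness
(`hom_ext_of_linearUnits`). For existence, `bassTate` lifts a symbol to {P, p₁, …} over K(t), with P
the minimal polynomial of θ, and takes minus the sum of the tame symbols at the places of degree
one. Weil reciprocity makes this well defined, and a residue computation identifies it with the norm
on symbols with one entry outside K. -/

noncomputable section

/-! ### Symbols and homomorphisms out of Milnor K-groups modulo `ℓ` -/

namespace MilnorKMod

theorem nsmul_eq_zero {ℓ : ℕ} {F : Type*} [Field F] {n : ℕ} (x : MilnorKMod ℓ F n) :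
    ℓ • x = 0 := by
  obtain ⟨y, rfl⟩ := Submodule.mkQ_surjective _ x
  rw [← map_nsmul]
  exact (Submodule.Quotient.mk_eq_zero _).2 ⟨y, by simp⟩

section lift

variable (ℓ : ℕ) {F : Type*} [Field F] {n : ℕ} {B : Type*} [AddCommGroup B]

theorem toMul_update (a : Fin n → Additive Fˣ) (i : Fin n) (z : Additive Fˣ) :
    (fun k => (Function.update a i z k).toMul) =
      Function.update (fun k => (a k).toMul) i z.toMul := by
  funext k
  rcases eq_or_ne k i with rfl | hk
  · simp
  · simp [hk]

/-- A function of `n` units that is multiplicative in every argument, as a multilinear map. -/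
def multilinearOfUnits (g : (Fin n → Fˣ) → B)
    (hmul : ∀ (a : Fin n → Fˣ) (i : Fin n) (x y : Fˣ), g (Function.update a i (x * y)) =
      g (Function.update a i x) + g (Function.update a i y)) :
    MultilinearMap ℤ (fun _ : Fin n => Additive Fˣ) B where
  toFun a := g (fun k => (a k).toMul)
  map_update_add' := by
    intro inst a i x y
    obtain rfl : inst = instDecidableEqFin n := Subsingleton.elim _ _
    simp only [toMul_update]
    exact hmul _ i _ _
  map_update_smul' := by
    intro inst a i c x
    obtain rfl : inst = instDecidableEqFin n := Subsingleton.elim _ _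
    simp only [toMul_update]
    exact map_zsmul (AddMonoidHom.mk' (fun x : Additive Fˣ =>
      g (Function.update (fun k => (a k).toMul) i x.toMul)) (fun _ _ => hmul _ i _ _)) c x

variable (g : (Fin n → Fˣ) → B)
    (hmul : ∀ (a : Fin n → Fˣ) (i : Fin n) (x y : Fˣ), g (Function.update a i (x * y)) =
      g (Function.update a i x) + g (Function.update a i y))
    (hst : ∀ (a : Fin n → Fˣ) (i j : Fin n), (j : ℕ) = (i : ℕ) + 1 →
      (a i : F) + (a j : F) = 1 → g a = 0)
    (hB : ∀ b : B, ℓ • b = 0)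

/-- A function of `n` units that is multiplicative in every argument and satisfies the Steinberg
relation induces a homomorphism `Kₙᴹ(F) → B`. -/
def liftMilnorK : MilnorK F n →+ B :=
  (Submodule.liftQ (steinbergRelations F n)
    (PiTensorProduct.lift (multilinearOfUnits g hmul)) (by
      rw [steinbergRelations, Submodule.span_le]
      rintro _ ⟨a, i, j, hij, ha, rfl⟩
      refine LinearMap.mem_ker.2 ?_
      rw [PiTensorProduct.lift.tprod]
      exact hst a i j hij ha)).toAddMonoidHom

/-- A function of `n` units that is multiplicative in every argument and satisfies the Steinberg
relation induces a homomorphism `kₙ(F) → B` if `B` is killed by `ℓ`. -/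
def lift : MilnorKMod ℓ F n →+ B :=
  (Submodule.liftQ _ (liftMilnorK g hmul hst).toIntLinearMap (by
      rintro _ ⟨x, rfl⟩
      refine LinearMap.mem_ker.2 ?_
      rw [LinearMap.lsmul_apply, Nat.cast_smul_eq_nsmul, AddMonoidHom.coe_toIntLinearMap,
        map_nsmul]
      exact hB _)).toAddMonoidHom

theorem lift_symbol (a : Fin n → Fˣ) : lift ℓ g hmul hst hB (symbol ℓ a) = g a := by
  change PiTensorProduct.lift (multilinearOfUnits g hmul) (PiTensorProduct.tprod ℤ _) = _
  rw [PiTensorProduct.lift.tprod]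
  rfl

end lift

/-! ### Calculus of symbols: left multiplication by units. -/

variable {ℓ : ℕ} {F : Type*} [Field F] {n : ℕ}

theorem symbol_update_mul (a : Fin n → Fˣ) (i : Fin n) (x y : Fˣ) :
    symbol ℓ (Function.update a i (x * y)) =
      symbol ℓ (Function.update a i x) + symbol ℓ (Function.update a i y) := by
  have key : ∀ z : Fˣ, (fun k => Additive.ofMul (Function.update a i z k)) =
      Function.update (fun k => Additive.ofMul (a k)) i (Additive.ofMul z) := fun z => by
    funext k
    rcases eq_or_ne k i with rfl | hk
    · simp
    · simp [hk]
  unfold symbol MilnorK.symbol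
  rw [key, key, key, ofMul_mul, MultilinearMap.map_update_add, map_add]
  exact map_add (ModN.mkQ ℓ) _ _

theorem symbol_eq_zero (a : Fin n → Fˣ) (i j : Fin n) (hij : (j : ℕ) = (i : ℕ) + 1)
    (h : (a i : F) + (a j : F) = 1) : symbol ℓ a = 0 := by
  have : MilnorK.symbol a = 0 :=
    (Submodule.Quotient.mk_eq_zero _).2 (Submodule.subset_span ⟨a, i, j, hij, h, rfl⟩)
  unfold symbol
  rw [this, map_zero]

/-- A subgroup of `kₙ(F)` that contains all symbols is everything. -/
theorem mem_of_symbol_mem (S : AddSubgroup (MilnorKMod ℓ F n))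
    (h : ∀ a : Fin n → Fˣ, symbol ℓ a ∈ S) (x : MilnorKMod ℓ F n) : x ∈ S := by
  have : QuotientAddGroup.mk' S = 0 := hom_ext fun a => by
    simpa using h a
  rw [← QuotientAddGroup.eq_zero_iff]
  exact DFunLike.congr_fun this x

/-- Left multiplication by `{c}`. -/
def mul (c : Fˣ) : MilnorKMod ℓ F n →+ MilnorKMod ℓ F (n + 1) :=
  lift ℓ (fun a => symbol ℓ (Fin.cons c a))
    (fun a i x y => by simp only [Fin.cons_update, symbol_update_mul])
    (fun a i j hij h => symbol_eq_zero _ i.succ j.succ (by simpa using hij) (by simpa using h))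
    nsmul_eq_zero

@[simp]
theorem mul_symbol (c : Fˣ) (a : Fin n → Fˣ) :
    mul c (symbol ℓ a) = symbol ℓ (Fin.cons c a) := lift_symbol _ _ _ _ _ _

theorem symbol_eq_mul (a : Fin (n + 1) → Fˣ) :
    symbol ℓ a = mul (a 0) (symbol ℓ (Fin.tail a)) := by
  rw [mul_symbol, Fin.cons_self_tail]

theorem mul_mul (a b : Fˣ) (x : MilnorKMod ℓ F n) : mul (a * b) x = mul a x + mul b x := by
  have : mul (ℓ := ℓ) (n := n) (a * b) = mul a + mul b := hom_ext fun c => by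
    have := symbol_update_mul (ℓ := ℓ) (Fin.cons 1 c : Fin (n + 1) → Fˣ) 0 a b
    simpa [Fin.update_cons_zero] using this
  rw [this, AddMonoidHom.add_apply]

@[simp]
theorem mul_unit_one (x : MilnorKMod ℓ F n) : mul 1 x = 0 := by
  simpa using mul_mul 1 1 x

theorem mul_unit_inv (a : Fˣ) (x : MilnorKMod ℓ F n) : mul a⁻¹ x = -mul a x := by
  rw [eq_neg_iff_add_eq_zero, ← mul_mul, inv_mul_cancel, mul_unit_one]

theorem mul_unit_div (a b : Fˣ) (x : MilnorKMod ℓ F n) : mul (a / b) x = mul a x - mul b x := by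
  rw [div_eq_mul_inv, mul_mul, mul_unit_inv, sub_eq_add_neg]

theorem mul_unit_pow (a : Fˣ) (k : ℕ) (x : MilnorKMod ℓ F n) : mul (a ^ k) x = k • mul a x := by
  induction k with
  | zero => simp
  | succ k ih => rw [pow_succ, mul_mul, ih, succ_nsmul]

theorem mul_unit_prod {ι : Type*} (s : Finset ι) (a : ι → Fˣ) (x : MilnorKMod ℓ F n) :
    mul (∏ i ∈ s, a i) x = ∑ i ∈ s, mul (a i) x := by
  classical
  induction s using Finset.induction_on with
  | empty => simp
  | insert i s hi ih => rw [Finset.prod_insert hi, Finset.sum_insert hi, mul_mul, ih]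

theorem mul_mul_eq_zero {a b : Fˣ} (h : (a : F) + b = 1) (x : MilnorKMod ℓ F n) :
    mul a (mul b x) = 0 := by
  have : (mul (ℓ := ℓ) (n := n + 1) a).comp (mul b) = 0 := hom_ext fun c => by
    simpa using symbol_eq_zero (Fin.cons a (Fin.cons b c : Fin (n + 1) → Fˣ)) 0 1 (by simp)
      (by simpa using h)
  exact DFunLike.congr_fun this x

/-- For a ≠ 1 write -a = (1 - a) / (1 - a⁻¹); the Steinberg relations for a and for a⁻¹ kill both
factors. -/
theorem mul_neg_self (a : Fˣ) (x : MilnorKMod ℓ F n) : mul a (mul (-a) x) = 0 := by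
  rcases eq_or_ne a 1 with rfl | ha
  · simp
  have h0 : (a : F) ≠ 0 := a.ne_zero
  have h1 : (1 : F) - a ≠ 0 := sub_ne_zero.2 fun h => ha (Units.ext h.symm)
  have h2 : (1 : F) - (a : F)⁻¹ ≠ 0 := sub_ne_zero.2 fun h => ha (by
    exact Units.ext (inv_eq_one.1 h.symm))
  have e : -a = Units.mk0 _ h1 / Units.mk0 _ h2 := by
    ext
    have h3 : (a : F) - 1 ≠ 0 := by rwa [← neg_sub, neg_ne_zero]
    push_cast
    simp only [Units.val_mk0]
    field_simp
    ring
  have e1 : mul a (mul (Units.mk0 _ h1) x) = 0 := mul_mul_eq_zero (by simp) x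
  have e2 : mul a⁻¹ (mul (Units.mk0 _ h2) x) = 0 := mul_mul_eq_zero (by simp) x
  rw [mul_unit_inv, neg_eq_zero] at e2
  rw [e, mul_unit_div, map_sub, e1, e2, sub_zero]

/-- Expand {ab, -ab} = 0 bilinearly and drop the terms {a, -a} and {b, -b}. -/
theorem mul_comm_neg (a b : Fˣ) (x : MilnorKMod ℓ F n) :
    mul a (mul b x) = -mul b (mul a x) := by
  have h := mul_neg_self (a * b) x
  have ha : mul a (mul (-(a * b)) x) = mul a (mul b x) := by
    rw [show -(a * b) = -a * b by simp, mul_mul, map_add, mul_neg_self, zero_add]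
  have hb : mul b (mul (-(a * b)) x) = mul b (mul a x) := by
    rw [show -(a * b) = -b * a by simp [mul_comm], mul_mul, map_add, mul_neg_self, zero_add]
  rw [mul_mul, ha, hb] at h
  exact eq_neg_of_add_eq_zero_left h

theorem mul_neg_one_add_self (x : MilnorKMod ℓ F n) : mul (-1) x + mul (-1) x = 0 := by
  rw [← mul_mul]
  simp

theorem mul_mul_self (a : Fˣ) (x : MilnorKMod ℓ F n) : mul a (mul a x) = mul a (mul (-1) x) := by
  have h := mul_neg_self a x
  rw [show -a = -1 * a by simp, mul_mul, map_add] at h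
  have h' := congrArg (mul a) (mul_neg_one_add_self x)
  rw [map_add, map_zero] at h'
  exact add_left_cancel (h.trans h'.symm)

/-- Moving b to the front takes j transpositions. This reduces statements about an arbitrary slot to
the first one. -/
theorem symbol_insertNth (j : Fin (n + 1)) (b : Fˣ) (a : Fin n → Fˣ) :
    symbol ℓ (j.insertNth b a : Fin (n + 1) → Fˣ) = (-1 : ℤ) ^ (j : ℕ) • mul b (symbol ℓ a) := by
  induction n with
  | zero =>
    obtain rfl : j = 0 := Fin.eq_zero j
    simp [Fin.insertNth_zero']
  | succ n ih =>
    refine Fin.cases (by simp [Fin.insertNth_zero']) (fun i => ?_) j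
    have ea := Fin.cons_self_tail a
    rw [← ea, Fin.insertNth_succ_cons, ← mul_symbol, ih, ← mul_symbol, mul_comm_neg b,
      map_zsmul, Fin.val_succ, pow_succ]
    simp

theorem symbol_update (j : Fin (n + 1)) (b : Fˣ) (a : Fin (n + 1) → Fˣ) :
    symbol ℓ (Function.update a j b) = (-1 : ℤ) ^ (j : ℕ) • mul b (symbol ℓ (j.removeNth a)) := by
  rw [← symbol_insertNth, Fin.insertNth_removeNth]

theorem map_mul_apply {F' : Type*} [Field F'] (φ : F →+* F') (c : Fˣ) (x : MilnorKMod ℓ F n) :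
    map ℓ φ (n + 1) (mul c x) = mul (Units.map (φ : F →* F') c) (map ℓ φ n x) := by
  have : (map ℓ φ (n + 1)).comp (mul c) =
      (mul (Units.map (φ : F →* F') c)).comp (map ℓ φ n) := hom_ext fun a => by
    simp only [AddMonoidHom.comp_apply, mul_symbol, map_symbol]
    congr 1
    funext k
    refine Fin.cases ?_ (fun i => ?_) k <;> simp
  exact DFunLike.congr_fun this x

theorem map_map {F' F'' : Type*} [Field F'] [Field F''] (φ : F →+* F') (ψ : F' →+* F'')
    (x : MilnorKMod ℓ F n) : map ℓ ψ n (map ℓ φ n x) = map ℓ (ψ.comp φ) n x := by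
  have : (map ℓ ψ n).comp (map ℓ φ n) = map ℓ (ψ.comp φ) n := hom_ext fun a => by
    simp only [AddMonoidHom.comp_apply, map_symbol]
    rfl
  exact DFunLike.congr_fun this x

theorem incl_mul {K L : Type*} [Field K] [Field L] [Algebra K L] (c : Kˣ)
    (x : MilnorKMod ℓ K n) :
    incl ℓ K L (n + 1) (mul c x) =
      mul (Units.map (algebraMap K L : K →* L) c) (incl ℓ K L n x) := map_mul_apply _ _ _

end MilnorKMod

/-! ### Generation by symbols with one entry outside of the base field -/

namespace MilnorKMod

variable (ℓ : ℕ) (K : Type*) {M : Type*} [Field K] [Field M] [Algebra K M] (n : ℕ)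

/-- The group generated by the units of `K` and the units of the form `x - c`, `c ∈ K`. -/
def linearUnits (x : M) : Subgroup Mˣ :=
  Subgroup.closure {u | (∃ c : K, (u : M) = algebraMap K M c) ∨
    ∃ c : K, (u : M) = x - algebraMap K M c}

variable {K} in
theorem map_mem_linearUnits (x : M) (c : Kˣ) :
    Units.map (algebraMap K M : K →* M) c ∈ linearUnits K x :=
  Subgroup.subset_closure (Or.inl ⟨c, rfl⟩)

/-- The subgroup of `kₙ₊₁(M)` generated by the `{g, a₁, …, aₙ}` with `g ∈ G`, `aᵢ ∈ K`. -/
def oneOutside (G : Subgroup Mˣ) : AddSubgroup (MilnorKMod ℓ M (n + 1)) :=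
  AddSubgroup.closure {z | ∃ g ∈ G, ∃ y : MilnorKMod ℓ K n, z = mul g (incl ℓ K M n y)}

variable {ℓ K n}

theorem mul_incl_mem_oneOutside {G : Subgroup Mˣ} {g : Mˣ} (hg : g ∈ G) (y : MilnorKMod ℓ K n) :
    mul g (incl ℓ K M n y) ∈ oneOutside ℓ K n G :=
  AddSubgroup.subset_closure ⟨g, hg, y, rfl⟩

/-- For c ≠ d, the Steinberg relation for (x - c)/(d - c) + (x - d)/(c - d) = 1 expresses {x - c, x
- d} through symbols with a constant entry. For c = d, use {g, g} = {g, -1}. -/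
theorem mul_mul_mem_oneOutside_of_linear {x : M} {g h : Mˣ} {c d : K}
    (hg : (g : M) = x - algebraMap K M c) (hh : (h : M) = x - algebraMap K M d)
    (y : MilnorKMod ℓ K n) :
    mul g (mul h (incl ℓ K M n y)) ∈ oneOutside ℓ K (n + 1) (linearUnits K x) := by
  have hgG : g ∈ linearUnits K x := Subgroup.subset_closure (Or.inr ⟨c, hg⟩)
  have hhG : h ∈ linearUnits K x := Subgroup.subset_closure (Or.inr ⟨d, hh⟩)
  rcases eq_or_ne c d with rfl | hcd
  · obtain rfl : g = h := Units.ext (hg.trans hh.symm)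
    rw [mul_mul_self]
    have := mul_incl_mem_oneOutside hgG (mul (-1) y)
    rw [incl_mul] at this
    convert this
    ext
    simp
  · have hdc : d - c ≠ 0 := sub_ne_zero.2 hcd.symm
    have hdc' : c - d ≠ 0 := sub_ne_zero.2 hcd
    let e : Kˣ := Units.mk0 _ hdc
    let e' : Kˣ := Units.mk0 _ hdc'
    let i : Kˣ →* Mˣ := Units.map (algebraMap K M : K →* M)
    have hK : algebraMap K M d - algebraMap K M c ≠ 0 := by
      rw [← map_sub]
      exact (map_ne_zero _).2 hdc
    have h1 : mul (g / i e) (mul (h / i e') (incl ℓ K M n y)) = 0 := mul_mul_eq_zero (by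
      push_cast
      simp only [i, e, e', Units.coe_map, Units.val_mk0, MonoidHom.coe_coe, hg, hh, map_sub]
      rw [show algebraMap K M c - algebraMap K M d = -(algebraMap K M d - algebraMap K M c) by ring,
        div_neg, ← sub_eq_add_neg, ← sub_div, div_eq_one_iff_eq hK]
      ring) _
    have h2 : mul g (mul h (incl ℓ K M n y)) = mul g (incl ℓ K M (n + 1) (mul e' y)) -
        mul h (incl ℓ K M (n + 1) (mul e y)) - mul (i e) (incl ℓ K M (n + 1) (mul e' y)) := by
      simp only [mul_unit_div, map_sub, sub_eq_zero] at h1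
      rw [mul_comm_neg (i e) h] at h1
      simp only [incl_mul]
      change _ = mul g (mul (i e') _) - mul h (mul (i e) _) - mul (i e) (mul (i e') _)
      rw [← sub_eq_zero] at h1 ⊢
      rw [← h1]
      abel
    rw [h2]
    exact sub_mem (sub_mem (mul_incl_mem_oneOutside hgG _) (mul_incl_mem_oneOutside hhG _))
      (mul_incl_mem_oneOutside (map_mem_linearUnits x e) _)

theorem mul_mul_mem_oneOutside {x : M} {g h : Mˣ} (hg : g ∈ linearUnits K x)
    (hh : h ∈ linearUnits K x) (y : MilnorKMod ℓ K n) :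
    mul g (mul h (incl ℓ K M n y)) ∈ oneOutside ℓ K (n + 1) (linearUnits K x) := by
  have key : ∀ u : Mˣ, ∀ c : K, (u : M) = algebraMap K M c →
      ∃ c' : Kˣ, u = Units.map (algebraMap K M : K →* M) c' := fun u c hc => by
    refine ⟨Units.mk0 c fun h0 => u.ne_zero (by rw [hc, h0, map_zero]), ?_⟩
    ext
    simp [hc]
  induction hg using Subgroup.closure_induction with
  | one => simp
  | mul a b _ _ ha hb => rw [mul_mul]; exact add_mem ha hb
  | inv a _ ha => rw [mul_unit_inv]; exact neg_mem ha
  | mem g hg =>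
    induction hh using Subgroup.closure_induction with
    | one => simp
    | mul a b _ _ ha hb => rw [mul_mul, map_add]; exact add_mem ha hb
    | inv a _ ha => rw [mul_unit_inv, map_neg]; exact neg_mem ha
    | mem h hh =>
      rcases hg with ⟨c, hg⟩ | ⟨c, hg'⟩
      · obtain ⟨c, rfl⟩ := key _ _ hg
        rw [mul_comm_neg, ← incl_mul]
        exact neg_mem (mul_incl_mem_oneOutside (Subgroup.subset_closure hh) _)
      · rcases hh with ⟨d, hh⟩ | ⟨d, hh⟩
        · obtain ⟨d, rfl⟩ := key _ _ hh
          rw [← incl_mul]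
          exact mul_incl_mem_oneOutside (Subgroup.subset_closure (Or.inr ⟨c, hg'⟩)) _
        · exact mul_mul_mem_oneOutside_of_linear hg' hh y

/-- Symbols in constants and linear polynomials in `x` are sums of such symbols with at most one
non-constant entry. -/
theorem symbol_mem_oneOutside {x : M} (a : Fin (n + 1) → Mˣ) (ha : ∀ i, a i ∈ linearUnits K x) :
    symbol ℓ a ∈ oneOutside ℓ K n (linearUnits K x) := by
  induction n with
  | zero =>
    rw [symbol_eq_mul]
    have : symbol ℓ (Fin.tail a) = incl ℓ K M 0 (symbol ℓ Fin.elim0) := by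
      rw [incl, map_symbol]
      congr 1
      exact Subsingleton.elim _ _
    rw [this]
    exact mul_incl_mem_oneOutside (ha 0) _
  | succ n ih =>
    rw [symbol_eq_mul]
    have h := ih (Fin.tail a) (fun i => ha i.succ)
    revert h
    generalize symbol ℓ (Fin.tail a) = z
    intro h
    induction h using AddSubgroup.closure_induction with
    | zero => simp
    | add _ _ _ _ h1 h2 => rw [map_add]; exact add_mem h1 h2
    | neg _ _ h1 => rw [map_neg]; exact neg_mem h1
    | mem z hz =>
      obtain ⟨g, hg, y, rfl⟩ := hz
      exact mul_mul_mem_oneOutside (ha 0) hg y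

/-- Additive maps that agree on the symbols `{g, a₁, …, aₙ}` with `aᵢ ∈ K` agree on `kₙ₊₁(M)`, if
every unit of `M` is a product of constants and linear polynomials in `x`. -/
theorem hom_ext_of_linearUnits {x : M} (hx : linearUnits K x = ⊤) {A : Type*} [AddCommGroup A]
    {f g : MilnorKMod ℓ M (n + 1) →+ A}
    (h : ∀ (b : Mˣ) (y : MilnorKMod ℓ K n),
      f (mul b (incl ℓ K M n y)) = g (mul b (incl ℓ K M n y))) : f = g := by
  have hle : oneOutside ℓ K n (linearUnits K x) ≤ f.eqLocus g := by
    rw [oneOutside, AddSubgroup.closure_le]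
    rintro _ ⟨b, -, y, rfl⟩
    exact h b y
  exact hom_ext fun a => hle (symbol_mem_oneOutside a fun i => hx ▸ Subgroup.mem_top _)

end MilnorKMod

/-! ### Tame symbols on fields of Laurent series -/

namespace MilnorKMod

section act

variable {ℓ : ℕ} {F : Type*} [Field F] {B : Type*} [AddCommGroup B]

/-- The result of applying the operators `μ a₁, …, μ aₙ` to `b₀`. -/
def iterateAct (μ : Fˣ → B →+ B) (b₀ : B) : (n : ℕ) → (Fin n → Fˣ) → B
  | 0, _ => b₀
  | n + 1, a => μ (a 0) (iterateAct μ b₀ n (Fin.tail a))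

variable (μ : Fˣ → B →+ B) (hmul : ∀ x y, μ (x * y) = μ x + μ y)
  (hst : ∀ x y : Fˣ, (x : F) + y = 1 → ∀ b, μ x (μ y b) = 0) (hB : ∀ b : B, ℓ • b = 0) (b₀ : B)

/-- The evaluation at `b₀` of the action on `B` given by operators `μ a` that satisfy the
Steinberg relation. -/
def act (n : ℕ) : MilnorKMod ℓ F n →+ B :=
  lift ℓ (iterateAct μ b₀ n)
    (by
      induction n with
      | zero => exact fun _ i => i.elim0
      | succ n ih =>
        intro a i x y
        refine Fin.cases ?_ (fun i => ?_) i
        · simp [iterateAct, hmul, Fin.tail_update_zero]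
        · simp [iterateAct, Fin.tail_update_succ, ih,
            Function.update_of_ne (Fin.succ_ne_zero i).symm])
    (by
      induction n with
      | zero => exact fun _ i => i.elim0
      | succ n ih =>
        intro a i j hij h
        obtain ⟨j, rfl⟩ : ∃ j' : Fin n, j = j'.succ :=
          ⟨j.pred (by rintro rfl; simp at hij), by simp⟩
        revert hij h
        refine Fin.cases (fun hij h => ?_) (fun i hij h => ?_) i
        · obtain _ | n := n
          · exact j.elim0
          · obtain rfl : j = 0 := by
              ext
              simpa using hij
            exact hst _ _ h _
        · change μ _ _ = 0
          rw [ih (Fin.tail a) i j (by simpa using hij) h, map_zero])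
    hB

theorem act_mul {n : ℕ} (c : Fˣ) (x : MilnorKMod ℓ F n) :
    act μ hmul hst hB b₀ (n + 1) (mul c x) = μ c (act μ hmul hst hB b₀ n x) := by
  have : (act μ hmul hst hB b₀ (n + 1)).comp (mul c) = (μ c).comp (act μ hmul hst hB b₀ n) :=
    hom_ext fun a => by
      simp only [AddMonoidHom.comp_apply, mul_symbol, act, lift_symbol]
      simp [iterateAct]
  exact DFunLike.congr_fun this x

theorem act_zero (a : Fin 0 → Fˣ) : act μ hmul hst hB b₀ 0 (symbol ℓ a) = b₀ :=
  lift_symbol _ _ _ _ _ _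

end act

/-! ### The graded target of the tame symbol. -/

section total

variable (ℓ : ℕ) (k : Type*) [Field k]

/-- The product of all the groups `kₙ(k)`. -/
abbrev Total : Type _ := ∀ n : ℕ, MilnorKMod ℓ k n

variable {ℓ k}

/-- Left multiplication by `{c}` on the product of all the groups `kₙ(k)`. -/
def mulTotal (c : kˣ) : Total ℓ k →+ Total ℓ k where
  toFun x n := match n with
    | 0 => 0
    | n + 1 => mul c (x n)
  map_zero' := by
    ext n
    cases n <;> simp
  map_add' x y := by
    ext n
    cases n <;> simp

@[simp]
theorem mulTotal_zero (c : kˣ) (x : Total ℓ k) : mulTotal c x 0 = 0 := rfl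

@[simp]
theorem mulTotal_succ (c : kˣ) (x : Total ℓ k) (n : ℕ) :
    mulTotal c x (n + 1) = mul c (x n) := rfl

theorem mulTotal_mul (c d : kˣ) (x : Total ℓ k) :
    mulTotal (c * d) x = mulTotal c x + mulTotal d x := by
  ext n
  cases n <;> simp [mul_mul]

@[simp]
theorem mulTotal_one (x : Total ℓ k) : mulTotal 1 x = 0 := by
  ext n
  cases n <;> simp

theorem mulTotal_mulTotal_eq_zero {c d : kˣ} (h : (c : k) + d = 1) (x : Total ℓ k) :
    mulTotal c (mulTotal d x) = 0 := by
  ext n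
  rcases n with _ | _ | n <;> simp [mul_mul_eq_zero h]

theorem mulTotal_neg_self (c : kˣ) (x : Total ℓ k) : mulTotal c (mulTotal (-c) x) = 0 := by
  ext n
  rcases n with _ | _ | n <;> simp [mul_neg_self]

theorem mulTotal_comm_neg (c d : kˣ) (x : Total ℓ k) :
    mulTotal c (mulTotal d x) = -mulTotal d (mulTotal c x) := by
  ext n
  rcases n with _ | _ | n <;> simp [mul_comm_neg c d]

theorem mulTotal_neg (c : kˣ) (x : Total ℓ k) :
    mulTotal (-c) x = mulTotal (-1) x + mulTotal c x := by
  rw [← mulTotal_mul, neg_mul, one_mul]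

theorem even_zsmul_mulTotal_neg_one {i : ℤ} (hi : Even i) (x : Total ℓ k) :
    i • mulTotal (-1) x = 0 := by
  obtain ⟨j, rfl⟩ := hi
  rw [← two_mul, mul_comm, mul_smul, two_zsmul, ← mulTotal_mul]
  simp

theorem mulTotal_single (c : kˣ) {n : ℕ} (x : MilnorKMod ℓ k n) :
    mulTotal c (Pi.single n x) = Pi.single (n + 1) (mul c x) := by
  ext m
  obtain _ | m := m
  · simp
  · rcases eq_or_ne m n with rfl | h
    · simp
    · simp [h]

/-- Left multiplication by `{u} + i ξ` on `k_*(k)[ξ] = k_*(k) ⊕ ξ k_*(k)`, where `ξ² = ξ {-1}` and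
`ξ` anticommutes with elements of degree one. -/
def tameOp (u : kˣ) (i : ℤ) : Total ℓ k × Total ℓ k →+ Total ℓ k × Total ℓ k where
  toFun z := (mulTotal u z.1, i • z.1 - mulTotal u z.2 + i • mulTotal (-1) z.2)
  map_zero' := by simp
  map_add' z w := by
    ext1
    · simp
    · simp only [Prod.snd_add, Prod.fst_add, smul_add, map_add]
      abel

theorem tameOp_apply (u : kˣ) (i : ℤ) (x y : Total ℓ k) :
    tameOp u i (x, y) = (mulTotal u x, i • x - mulTotal u y + i • mulTotal (-1) y) := rfl

theorem tameOp_mul (u w : kˣ) (i j : ℤ) :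
    tameOp (ℓ := ℓ) (u * w) (i + j) = tameOp u i + tameOp w j := by
  ext1 ⟨x, y⟩
  simp only [AddMonoidHom.add_apply, tameOp_apply, mulTotal_mul, add_smul, Prod.mk_add_mk]
  ext1
  · rfl
  · dsimp only
    abel

@[simp]
theorem tameOp_one_zero (z : Total ℓ k × Total ℓ k) : tameOp 1 0 z = 0 := by
  obtain ⟨x, y⟩ := z
  simp [tameOp_apply]

theorem tameOp_tameOp_of_add_eq_one {u w : kˣ} (h : (u : k) + w = 1)
    (z : Total ℓ k × Total ℓ k) : tameOp u 0 (tameOp w 0 z) = 0 := by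
  obtain ⟨x, y⟩ := z
  simp [tameOp_apply, mulTotal_mulTotal_eq_zero h]

/-- This is {f, -f} = 0 for a series f of order i and leading coefficient u. After anticommuting {u}
and {-1}, only multiples of {-1} with the even coefficients i(i + 1) and i(i - 1) remain. -/
theorem tameOp_tameOp_neg (u : kˣ) (i : ℤ) (z : Total ℓ k × Total ℓ k) :
    tameOp u i (tameOp (-u) i z) = 0 := by
  obtain ⟨x, y⟩ := z
  have h1 : (i * (i + 1)) • mulTotal (-1) x = 0 :=
    even_zsmul_mulTotal_neg_one (Int.even_mul_succ_self i) x
  have h2 : (i * (i - 1)) • mulTotal (-1) (mulTotal (-1) y) = 0 :=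
    even_zsmul_mulTotal_neg_one (Int.even_mul_pred_self i) _
  have h3 : mulTotal u (mulTotal (-1) y) = -mulTotal (-1) (mulTotal u y) := mulTotal_comm_neg ..
  simp only [tameOp_apply, mulTotal_neg_self, Prod.mk_eq_zero, true_and, map_add, map_sub,
    map_zsmul, smul_add, smul_sub]
  rw [mulTotal_neg u x, mulTotal_neg u y, map_add, h3]
  linear_combination (norm := module) h1 + h2

end total

/-! ### Orders and leading coefficients of Laurent series, and the resulting action. -/

variable (ℓ : ℕ) {k : Type*} [Field k] {F : Type*} [Field F]

/-- The leading coefficient of a nonzero Laurent series. -/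
def leadUnit (f : (LaurentSeries k)ˣ) : kˣ :=
  Units.mk0 (f : LaurentSeries k).leadingCoeff (HahnSeries.leadingCoeff_ne_zero.2 f.ne_zero)

theorem leadUnit_mul (f g : (LaurentSeries k)ˣ) : leadUnit (f * g) = leadUnit f * leadUnit g := by
  ext
  simp [leadUnit, HahnSeries.leadingCoeff_mul]

theorem order_units_mul (f g : (LaurentSeries k)ˣ) :
    ((f * g : (LaurentSeries k)ˣ) : LaurentSeries k).order =
      (f : LaurentSeries k).order + (g : LaurentSeries k).order := by
  rw [Units.val_mul, HahnSeries.order_mul f.ne_zero g.ne_zero]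

theorem order_leadingCoeff_of_coeff {f : LaurentSeries k} {i : ℤ} (h0 : f.coeff i ≠ 0)
    (h : ∀ j < i, f.coeff j = 0) : f.order = i ∧ f.leadingCoeff = f.coeff i := by
  have hf : f ≠ 0 := by
    rintro rfl
    simp at h0
  have hi : f.order = i := by
    refine le_antisymm (HahnSeries.order_le_of_coeff_ne_zero h0) ?_
    rw [HahnSeries.le_order_iff_forall hf]
    exact h
  exact ⟨hi, by rw [HahnSeries.leadingCoeff_eq, hi]⟩

/-- Split by orders. If f has a pole, g has the same order and the opposite leading coefficient, so
the relation for {f, -f} applies. If both orders are 0, the leading coefficients add up to 1. If one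
order is positive, the other series has order 0 and leading coefficient 1, so its operator is zero.
-/
theorem tameOp_steinberg {f g : (LaurentSeries k)ˣ}
    (h : (f : LaurentSeries k) + (g : LaurentSeries k) = 1) (z : Total ℓ k × Total ℓ k) :
    tameOp (leadUnit f) (f : LaurentSeries k).order
      (tameOp (leadUnit g) (g : LaurentSeries k).order z) = 0 := by
  have hc : ∀ j, (f : LaurentSeries k).coeff j + (g : LaurentSeries k).coeff j =
      if j = 0 then 1 else 0 := fun j => by
    rw [← HahnSeries.coeff_add, h, HahnSeries.coeff_one]
    split_ifs <;> rfl
  have key : ∀ f g : (LaurentSeries k)ˣ, (∀ j, (f : LaurentSeries k).coeff j +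
      (g : LaurentSeries k).coeff j = if j = 0 then 1 else 0) → 0 < (f : LaurentSeries k).order →
      (g : LaurentSeries k).order = 0 ∧ leadUnit g = 1 := fun f g hc hf => by
    have hg : ∀ j, j ≤ 0 → (g : LaurentSeries k).coeff j = if j = 0 then 1 else 0 := fun j hj => by
      rw [← hc, HahnSeries.coeff_eq_zero_of_lt_order (hj.trans_lt hf), zero_add]
    have h1 : (g : LaurentSeries k).coeff 0 = 1 := by simpa using hg 0 le_rfl
    obtain ⟨h2, h3⟩ := order_leadingCoeff_of_coeff (f := (g : LaurentSeries k)) (i := 0)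
      (by simp [h1]) (fun j hj => by simpa [hj.ne] using hg j hj.le)
    exact ⟨h2, Units.ext (h3.trans h1)⟩
  rcases lt_trichotomy (f : LaurentSeries k).order 0 with hf | hf | hf
  · have hg : ∀ j < 0, (g : LaurentSeries k).coeff j = -(f : LaurentSeries k).coeff j :=
      fun j hj => by
        have := hc j
        rw [if_neg hj.ne] at this
        exact eq_neg_of_add_eq_zero_right this
    obtain ⟨h2, h3⟩ := order_leadingCoeff_of_coeff (f := (g : LaurentSeries k))
      (i := (f : LaurentSeries k).order)
      (by
        rw [hg _ hf, neg_ne_zero, Ne, HahnSeries.coeff_order_eq_zero]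
        exact f.ne_zero)
      (fun j hj => by
        rw [hg _ (hj.trans hf), HahnSeries.coeff_eq_zero_of_lt_order hj, neg_zero])
    have h4 : leadUnit g = -leadUnit f := by
      ext
      change (g : LaurentSeries k).leadingCoeff = -(f : LaurentSeries k).leadingCoeff
      rw [h3, hg _ hf, HahnSeries.leadingCoeff_eq]
    rw [h2, h4]
    exact tameOp_tameOp_neg _ _ _
  · rcases lt_trichotomy (g : LaurentSeries k).order 0 with hg | hg | hg
    · have h1 := hc (g : LaurentSeries k).order
      rw [if_neg hg.ne, HahnSeries.coeff_eq_zero_of_lt_order (hg.trans_eq hf.symm), zero_add,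
        HahnSeries.coeff_order_eq_zero] at h1
      exact absurd h1 g.ne_zero
    · rw [hf, hg]
      refine tameOp_tameOp_of_add_eq_one ?_ z
      change (f : LaurentSeries k).leadingCoeff + (g : LaurentSeries k).leadingCoeff = 1
      rw [HahnSeries.leadingCoeff_eq, HahnSeries.leadingCoeff_eq, hf, hg]
      simpa using hc 0
    · obtain ⟨h1, h2⟩ := key g f (fun j => by rw [add_comm, hc]) hg
      rw [h1, h2, tameOp_one_zero]
  · obtain ⟨h1, h2⟩ := key f g hc hf
    rw [h1, h2, tameOp_one_zero, map_zero]

/-- The action of `kₙ(F)` on `k_*(k) ⊕ ξ k_*(k)` given by an embedding of `F` into the field of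
Laurent series over `k`, evaluated at `1`. Its second component is the tame symbol. -/
def placeAct (φ : F →+* LaurentSeries k) (n : ℕ) : MilnorKMod ℓ F n →+ Total ℓ k × Total ℓ k :=
  (act (fun f : (LaurentSeries k)ˣ => tameOp (leadUnit f) (f : LaurentSeries k).order)
    (fun f g => by rw [leadUnit_mul, order_units_mul, tameOp_mul])
    (fun _ _ h z => tameOp_steinberg ℓ h z)
    (fun b => by
      ext n
      · exact nsmul_eq_zero _
      · exact nsmul_eq_zero _)
    (Pi.single 0 (symbol ℓ Fin.elim0), 0) n).comp (map ℓ φ n)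

variable {ℓ} (φ : F →+* LaurentSeries k) {n : ℕ}

theorem placeAct_mul {c : Fˣ} {u : k} {i : ℤ} (hi : (φ c).order = i)
    (hu : (φ c).leadingCoeff = u) (x : MilnorKMod ℓ F n) :
    placeAct ℓ φ (n + 1) (mul c x) = tameOp (Units.mk0 u (by
      rw [← hu]
      exact HahnSeries.leadingCoeff_ne_zero.2 ((map_ne_zero φ).2 c.ne_zero))) i
      (placeAct ℓ φ n x) := by
  subst hi hu
  rw [placeAct, AddMonoidHom.comp_apply, map_mul_apply, act_mul]
  rfl

theorem placeAct_symbol_zero (a : Fin 0 → Fˣ) :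
    placeAct ℓ φ 0 (symbol ℓ a) = (Pi.single 0 (symbol ℓ Fin.elim0), 0) := by
  rw [placeAct, AddMonoidHom.comp_apply, map_symbol, act_zero]

theorem placeAct_incl [Algebra k F] (hφ : ∀ c : k, φ (algebraMap k F c) = HahnSeries.C c)
    (y : MilnorKMod ℓ k n) : placeAct ℓ φ n (incl ℓ k F n y) = (Pi.single n y, 0) := by
  suffices h : (placeAct ℓ φ n).comp (incl ℓ k F n) =
      (AddMonoidHom.inl _ _).comp (AddMonoidHom.single (fun n => MilnorKMod ℓ k n) n) from
    DFunLike.congr_fun h y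
  clear y
  refine hom_ext fun a => ?_
  simp only [AddMonoidHom.comp_apply]
  induction n with
  | zero =>
    rw [incl, map_symbol, placeAct_symbol_zero]
    have : a = Fin.elim0 := Subsingleton.elim _ _
    rw [this]
    rfl
  | succ n ih =>
    rw [symbol_eq_mul, incl_mul, placeAct_mul φ (i := 0) (u := a 0)
      (by simp [hφ]) (by
        simp only [Units.coe_map, MonoidHom.coe_coe, hφ]
        exact HahnSeries.leadingCoeff_of_single), ih]
    simp [tameOp_apply, mulTotal_single]

theorem placeAct_symbol_snd (a : Fin n → Fˣ) (ha : ∀ i, (φ (a i)).order = 0) :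
    (placeAct ℓ φ n (symbol ℓ a)).2 = 0 := by
  induction n with
  | zero => rw [placeAct_symbol_zero]
  | succ n ih =>
    rw [symbol_eq_mul, placeAct_mul φ (ha 0) rfl]
    have h := ih (Fin.tail a) (fun i => ha i.succ)
    revert h
    generalize placeAct ℓ φ n (symbol ℓ (Fin.tail a)) = z
    obtain ⟨x, y⟩ := z
    rintro rfl
    simp [tameOp_apply]

theorem placeAct_mul_incl [Algebra k F] (hφ : ∀ c : k, φ (algebraMap k F c) = HahnSeries.C c)
    {c : Fˣ} {u : k} {i : ℤ} (hi : (φ c).order = i) (hu : (φ c).leadingCoeff = u)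
    (y : MilnorKMod ℓ k n) :
    (placeAct ℓ φ (n + 1) (mul c (incl ℓ k F n y))).2 = i • Pi.single n y := by
  rw [placeAct_mul φ hi hu, placeAct_incl φ hφ]
  simp [tameOp_apply]

theorem placeAct_mul_mul_incl [Algebra k F] (hφ : ∀ c : k, φ (algebraMap k F c) = HahnSeries.C c)
    {p c : Fˣ} {u w : kˣ} {i : ℤ} (hp : (φ p).order = 0) (hu : (φ p).leadingCoeff = u)
    (hi : (φ c).order = i) (hw : (φ c).leadingCoeff = w) (y : MilnorKMod ℓ k n) :
    (placeAct ℓ φ (n + 2) (mul p (mul c (incl ℓ k F n y)))).2 (n + 1) = -(i • mul u y) := by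
  rw [placeAct_mul φ hp hu, placeAct_mul φ hi hw, placeAct_incl φ hφ]
  simp [tameOp_apply]

/-- Used at infinity, where a monic polynomial of degree ℓ is invisible modulo ℓ. -/
theorem placeAct_mul_of_dvd {p : Fˣ} {i : ℤ} (hi : (ℓ : ℤ) ∣ i) (hp : (φ p).order = i)
    (hu : (φ p).leadingCoeff = 1) (x : MilnorKMod ℓ F n) :
    placeAct ℓ φ (n + 1) (mul p x) = 0 := by
  rw [placeAct_mul φ hp hu]
  obtain ⟨j, rfl⟩ := hi
  obtain ⟨x, y⟩ := placeAct ℓ φ n x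
  have h : ∀ z : Total ℓ k, ((ℓ : ℤ) * j) • z = 0 := fun z => by
    rw [mul_comm, mul_smul, natCast_zsmul]
    ext m
    simp [nsmul_eq_zero]
  have h1 : Units.mk0 (1 : k) one_ne_zero = 1 := Units.ext rfl
  simp [tameOp_apply, h, h1]

open Polynomial

/-! ### The places of a rational function field of degree one -/

section places

variable {K : Type*} [Field K]

theorem algebraMap_laurentSeries (a : K) : algebraMap K (LaurentSeries K) a = HahnSeries.C a := by
  rw [HahnSeries.algebraMap_apply', PowerSeries.algebraMap_eq, HahnSeries.ofPowerSeries_C]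

theorem aeval_single_monomial (z : ℤ) (n : ℕ) (a : K) :
    aeval (HahnSeries.single z (1 : K) : LaurentSeries K) (monomial n a) =
      HahnSeries.single (n * z) a := by
  rw [aeval_monomial, HahnSeries.single_pow, algebraMap_laurentSeries]
  simp

theorem coeff_aeval_single {z : ℤ} (hz : z ≠ 0) (p : K[X]) (j : ℕ) :
    (aeval (HahnSeries.single z (1 : K) : LaurentSeries K) p).coeff (j * z) = p.coeff j := by
  induction p using Polynomial.induction_on' with
  | add p q hp hq => rw [map_add, HahnSeries.coeff_add, hp, hq, Polynomial.coeff_add]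
  | monomial n a =>
    rw [aeval_single_monomial, coeff_monomial]
    split_ifs with h
    · rw [h, HahnSeries.coeff_single_same]
    · rw [HahnSeries.coeff_single_of_ne]
      intro h'
      exact h (by exact_mod_cast (mul_right_cancel₀ hz h').symm)

theorem coeff_aeval_single_eq_zero {z m : ℤ} (p : K[X]) (hm : ∀ j : ℕ, m ≠ j * z) :
    (aeval (HahnSeries.single z (1 : K) : LaurentSeries K) p).coeff m = 0 := by
  induction p using Polynomial.induction_on' with
  | add p q hp hq => rw [map_add, HahnSeries.coeff_add, hp, hq, add_zero]
  | monomial n a =>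
    rw [aeval_single_monomial, HahnSeries.coeff_single_of_ne (hm n)]

theorem aeval_single_injective {z : ℤ} (hz : z ≠ 0) :
    Function.Injective (aeval (R := K) (HahnSeries.single z (1 : K) : LaurentSeries K)) := by
  rw [injective_iff_map_eq_zero]
  intro p hp
  ext j
  rw [← coeff_aeval_single hz, hp]
  simp

/-- The expansion of rational functions at `c`. -/
def placeAt (c : K) : RatFunc K →+* LaurentSeries K :=
  IsFractionRing.lift (A := K[X])
    (g := ((aeval (HahnSeries.single 1 (1 : K) : LaurentSeries K)).comp
      (aeval (X + C c : K[X]))).toRingHom)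
    ((aeval_single_injective one_ne_zero).comp (taylor_injective c))

variable (K) in
/-- The expansion of rational functions at infinity. -/
def placeInf : RatFunc K →+* LaurentSeries K :=
  IsFractionRing.lift (A := K[X])
    (g := (aeval (HahnSeries.single (-1) (1 : K) : LaurentSeries K)).toRingHom)
    (aeval_single_injective (by simp))

theorem placeAt_algebraMap (c : K) (p : K[X]) : placeAt c (algebraMap K[X] (RatFunc K) p) =
    aeval (HahnSeries.single 1 (1 : K) : LaurentSeries K) (p.comp (X + C c)) :=
  IsFractionRing.lift_algebraMap _ _

theorem placeInf_algebraMap (p : K[X]) : placeInf K (algebraMap K[X] (RatFunc K) p) =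
    aeval (HahnSeries.single (-1) (1 : K) : LaurentSeries K) p :=
  IsFractionRing.lift_algebraMap _ _

theorem algebraMap_eq_algebraMap_C (a : K) :
    algebraMap K (RatFunc K) a = algebraMap K[X] (RatFunc K) (C a) := by
  rw [IsScalarTower.algebraMap_apply K K[X] (RatFunc K)]
  rfl

theorem placeAt_const (c a : K) :
    placeAt c (algebraMap K (RatFunc K) a) = HahnSeries.C a := by
  rw [algebraMap_eq_algebraMap_C, placeAt_algebraMap, C_comp, aeval_C,
    algebraMap_laurentSeries]

theorem placeInf_const (a : K) :
    placeInf K (algebraMap K (RatFunc K) a) = HahnSeries.C a := by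
  rw [algebraMap_eq_algebraMap_C, placeInf_algebraMap, aeval_C, algebraMap_laurentSeries]

theorem placeAt_of_eval_ne_zero {c : K} {p : K[X]} (h : p.eval c ≠ 0) :
    (placeAt c (algebraMap K[X] (RatFunc K) p)).order = 0 ∧
      (placeAt c (algebraMap K[X] (RatFunc K) p)).leadingCoeff = p.eval c := by
  have h0 : (placeAt c (algebraMap K[X] (RatFunc K) p)).coeff 0 = p.eval c := by
    have := coeff_aeval_single (z := 1) one_ne_zero (p.comp (X + C c)) 0
    rw [placeAt_algebraMap]
    rw [coeff_zero_eq_eval_zero] at this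
    simpa using this
  rw [← h0]
  refine order_leadingCoeff_of_coeff (by rwa [h0]) fun j hj => ?_
  rw [placeAt_algebraMap]
  exact coeff_aeval_single_eq_zero _ fun i => by omega

theorem placeAt_X_sub_C_self (c : K) :
    (placeAt c (algebraMap K[X] (RatFunc K) (X - C c))).order = 1 ∧
      (placeAt c (algebraMap K[X] (RatFunc K) (X - C c))).leadingCoeff = 1 := by
  rw [placeAt_algebraMap]
  have : (X - C c).comp (X + C c) = monomial 1 (1 : K) := by
    simp [monomial_one_one_eq_X]
  rw [this, aeval_single_monomial]
  refine ⟨?_, HahnSeries.leadingCoeff_of_single⟩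
  rw [HahnSeries.order_single one_ne_zero]
  simp

theorem placeInf_algebraMap_order {p : K[X]} (hp : p ≠ 0) :
    (placeInf K (algebraMap K[X] (RatFunc K) p)).order = -p.natDegree ∧
      (placeInf K (algebraMap K[X] (RatFunc K) p)).leadingCoeff = p.leadingCoeff := by
  rw [placeInf_algebraMap]
  have h := coeff_aeval_single (z := -1) (by simp) p
  have h0 := h p.natDegree
  rw [mul_neg_one, coeff_natDegree] at h0
  rw [← h0]
  refine order_leadingCoeff_of_coeff (by rw [h0]; exact leadingCoeff_ne_zero.2 hp) fun j hj => ?_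
  by_cases hj' : ∃ i : ℕ, j = i * (-1)
  · obtain ⟨i, rfl⟩ := hj'
    rw [h]
    exact coeff_eq_zero_of_natDegree_lt (by omega)
  · push Not at hj'
    exact coeff_aeval_single_eq_zero _ hj'

theorem finite_order_placeAt_ne_zero (f : (RatFunc K)ˣ) :
    {c : K | (placeAt c (f : RatFunc K)).order ≠ 0}.Finite := by
  obtain ⟨p, q, hq, hf⟩ := IsFractionRing.div_surjective K[X] (f : RatFunc K)
  have hq0 : q ≠ 0 := nonZeroDivisors.ne_zero hq
  have hp0 : p ≠ 0 := by
    rintro rfl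
    rw [map_zero, zero_div] at hf
    exact f.ne_zero hf.symm
  -- Only roots of the numerator or the denominator can be zeros or poles.
  refine ((p * q).rootSet_finite K).subset fun c hc => ?_
  rw [mem_rootSet]
  refine ⟨mul_ne_zero hp0 hq0, ?_⟩
  by_contra h
  rw [coe_aeval_eq_eval, eval_mul, mul_eq_zero, not_or] at h
  refine hc ?_
  have hf' : (f : RatFunc K) * algebraMap K[X] (RatFunc K) q = algebraMap K[X] (RatFunc K) p := by
    rw [← hf, div_mul_cancel₀]
    simpa using hq0
  have h1 := congrArg (fun g => (placeAt c g).order) hf'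
  rw [RingHom.map_mul] at h1
  rw [HahnSeries.order_mul ((_root_.map_ne_zero _).2 f.ne_zero)
    ((_root_.map_ne_zero _).2 (by simpa using hq0)), (placeAt_of_eval_ne_zero h.1).1,
    (placeAt_of_eval_ne_zero h.2).1, add_zero] at h1
  exact h1

end places

/-! ### The sum of all tame symbols of degree one -/

section residues

variable {ℓ : ℕ} {K : Type*} [Field K] {n : ℕ}

/-- The tame symbol `kₙ₊₁(K(t)) → kₙ(K)` at `c`. -/
def residueAt (c : K) (n : ℕ) : MilnorKMod ℓ (RatFunc K) (n + 1) →+ MilnorKMod ℓ K n :=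
  (Pi.evalAddMonoidHom _ n).comp ((AddMonoidHom.snd _ _).comp (placeAct ℓ (placeAt c) (n + 1)))

/-- Finiteness is what makes the `finsum` of residues additive in x. -/
theorem finite_support_residueAt (x : MilnorKMod ℓ (RatFunc K) (n + 1)) :
    (Function.support fun c : K => residueAt c n x).Finite := by
  let S : AddSubgroup (MilnorKMod ℓ (RatFunc K) (n + 1)) :=
    { carrier := {x | (Function.support fun c : K => residueAt c n x).Finite}
      zero_mem' := by simp
      add_mem' := fun {x y} hx hy => (hx.union hy).subset (by
        simp only [map_add]
        exact Function.support_add _ _)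
      neg_mem' := fun {x} hx => by
        simpa only [Set.mem_ofPred_eq, map_neg, Function.support_fun_neg] using hx }
  refine mem_of_symbol_mem S (fun a => ?_) x
  refine (Set.finite_iUnion fun i => finite_order_placeAt_ne_zero (a i)).subset fun c hc => ?_
  by_contra h
  simp only [Set.mem_iUnion, Set.mem_ofPred_eq, not_exists, not_not] at h
  refine hc ?_
  change (placeAct ℓ (placeAt c) (n + 1) (symbol ℓ a)).2 n = 0
  rw [placeAct_symbol_snd _ _ h]
  rfl

/-- The sum of the tame symbols at all `c ∈ K` and at infinity. -/
def residueSum (n : ℕ) : MilnorKMod ℓ (RatFunc K) (n + 1) →+ MilnorKMod ℓ K n where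
  toFun x := (placeAct ℓ (placeInf K) (n + 1) x).2 n + ∑ᶠ c : K, residueAt c n x
  map_zero' := by simp
  map_add' x y := by
    simp only [map_add]
    rw [finsum_add_distrib (finite_support_residueAt x) (finite_support_residueAt y)]
    simp only [Prod.snd_add, Pi.add_apply]
    abel

theorem residueSum_apply (x : MilnorKMod ℓ (RatFunc K) (n + 1)) :
    residueSum n x = (placeAct ℓ (placeInf K) (n + 1) x).2 n + ∑ᶠ c : K, residueAt c n x := rfl

theorem residueSum_const (a : Kˣ) (y : MilnorKMod ℓ K n) :
    residueSum n (mul (Units.map (algebraMap K (RatFunc K) : K →* RatFunc K) a)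
      (incl ℓ K (RatFunc K) n y)) = 0 := by
  rw [← incl_mul, residueSum_apply, placeAct_incl _ placeInf_const]
  simp only [residueAt, AddMonoidHom.comp_apply, placeAct_incl _ (placeAt_const _)]
  simp

/-- The polynomial t - c has a simple zero at c and a simple pole at infinity; the residues y and -y
cancel. -/
theorem residueSum_linear {f : (RatFunc K)ˣ} {c : K}
    (hf : (f : RatFunc K) = algebraMap K[X] (RatFunc K) (X - C c)) (y : MilnorKMod ℓ K n) :
    residueSum n (mul f (incl ℓ K (RatFunc K) n y)) = 0 := by
  rw [residueSum_apply, finsum_eq_single _ c]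
  · have h1 := placeInf_algebraMap_order (X_sub_C_ne_zero c)
    have h2 := placeAt_X_sub_C_self c
    rw [← hf] at h1 h2
    simp only [residueAt, AddMonoidHom.comp_apply, AddMonoidHom.coe_snd,
      Pi.evalAddMonoidHom_apply]
    rw [placeAct_mul_incl _ placeInf_const h1.1 h1.2,
      placeAct_mul_incl _ (placeAt_const c) h2.1 h2.2]
    simp
  · intro d hd
    have h := placeAt_of_eval_ne_zero (c := d) (p := X - C c) (by simpa [sub_eq_zero] using hd)
    rw [← hf] at h
    simp only [residueAt, AddMonoidHom.comp_apply, AddMonoidHom.coe_snd,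
      Pi.evalAddMonoidHom_apply]
    rw [placeAct_mul_incl _ (placeAt_const d) h.1 h.2]
    simp

/-- Weil reciprocity: the sum of all residues of a symbol in constants and linear polynomials
vanishes. -/
theorem residueSum_symbol (a : Fin (n + 1) → (RatFunc K)ˣ)
    (ha : ∀ i, a i ∈ linearUnits K (RatFunc.X : RatFunc K)) :
    residueSum (ℓ := ℓ) n (symbol ℓ a) = 0 := by
  have hle : oneOutside ℓ K n (linearUnits K (RatFunc.X : RatFunc K)) ≤
      (residueSum (ℓ := ℓ) (K := K) n).ker := by
    rw [oneOutside, AddSubgroup.closure_le]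
    rintro _ ⟨g, hg, y, rfl⟩
    change residueSum n _ = 0
    induction hg using Subgroup.closure_induction with
    | one => simp
    | mul a b _ _ ha hb => rw [mul_mul, map_add, ha, hb, add_zero]
    | inv a _ ha => rw [mul_unit_inv, map_neg, ha, neg_zero]
    | mem g hg =>
      rcases hg with ⟨c, hc⟩ | ⟨c, hc⟩
      · have hc0 : c ≠ 0 := by
          rintro rfl
          exact g.ne_zero (by rw [hc, map_zero])
        obtain rfl : g = Units.map (algebraMap K (RatFunc K) : K →* RatFunc K)
            (Units.mk0 c hc0) := Units.ext hc
        exact residueSum_const _ y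
      · refine residueSum_linear (c := c) ?_ y
        rw [hc, map_sub, RatFunc.algebraMap_X, algebraMap_eq_algebraMap_C]
  exact hle (symbol_mem_oneOutside a ha)

end residues

/-! ### Existence and uniqueness of the transfer -/

theorem mem_linearUnits_of_splits {K M : Type*} [Field K] [Field M] [Algebra K M] {x : M}
    {p : K[X]} (hp : p.Splits) {u : Mˣ} (hu : (u : M) = aeval x p) : u ∈ linearUnits K x := by
  induction hp using Submonoid.closure_induction generalizing u with
  | one =>
    obtain rfl : u = 1 := Units.ext (by simpa using hu)
    exact one_mem _
  | mul p q _ _ hp hq =>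
    rw [map_mul] at hu
    have h := u.ne_zero
    rw [hu] at h
    have : u = Units.mk0 _ (left_ne_zero_of_mul h) * Units.mk0 _ (right_ne_zero_of_mul h) :=
      Units.ext hu
    rw [this]
    exact mul_mem (hp rfl) (hq rfl)
  | mem p hp =>
    refine Subgroup.subset_closure ?_
    rcases hp with ⟨c, rfl⟩ | ⟨c, rfl⟩
    · exact Or.inl ⟨c, by simpa using hu⟩
    · exact Or.inr ⟨-c, by simpa using hu⟩

/-- Since θ generates L, the characteristic polynomial of multiplication by θ is the minimal
polynomial. -/
theorem norm_algebraMap_sub {K L : Type*} [Field K] [Field L] [Algebra K L]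
    [FiniteDimensional K L] {θ : L} (hθ : (minpoly K θ).natDegree = Module.finrank K L) (c : K) :
    Algebra.norm K (algebraMap K L c - θ) = (minpoly K θ).eval c := by
  have h : (Algebra.lmul K L θ).charpoly = minpoly K θ := by
    refine eq_of_monic_of_dvd_of_natDegree_le (minpoly.monic (Algebra.IsIntegral.isIntegral θ))
      (LinearMap.charpoly_monic (Algebra.lmul K L θ)) ?_ ?_
    · rw [← minpoly.algHom_eq (Algebra.lmul K L) Algebra.lmul_injective θ]
      exact LinearMap.minpoly_dvd_charpoly _
    · rw [LinearMap.charpoly_natDegree, hθ]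
  rw [← h, LinearMap.eval_charpoly, Algebra.norm_apply, map_sub]
  congr 1
  ext y
  simp

section transfer

variable {K L : Type u} [Field K] [Field L] [Algebra K L] [FiniteDimensional K L] {θ : L}
  (hθ : (minpoly K θ).natDegree = Module.finrank K L)

include hθ in
theorem exists_degree_lt_aeval (x : L) :
    ∃ p : K[X], p.degree < (minpoly K θ).degree ∧ aeval θ p = x := by
  have hi : IsIntegral K θ := Algebra.IsIntegral.isIntegral θ
  have hx : x ∈ IntermediateField.adjoin K {θ} := by
    rw [(Field.primitive_element_iff_minpoly_natDegree_eq K θ).2 hθ]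
    trivial
  rw [← IntermediateField.mem_toSubalgebra,
    IntermediateField.adjoin_simple_toSubalgebra_of_isAlgebraic hi.isAlgebraic,
    Algebra.adjoin_singleton_eq_range_aeval] at hx
  obtain ⟨p, rfl⟩ := hx
  exact ⟨p %ₘ minpoly K θ, degree_modByMonic_lt _ (minpoly.monic hi),
    minpoly.aeval_modByMonic_minpoly p θ⟩

/-- The polynomial in `θ` of least degree that represents an element of `L = K(θ)`. -/
def repr (x : L) : K[X] := (exists_degree_lt_aeval hθ x).choose

theorem degree_repr_lt (x : L) : (repr hθ x).degree < (minpoly K θ).degree :=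
  (exists_degree_lt_aeval hθ x).choose_spec.1

@[simp]
theorem aeval_repr (x : L) : aeval θ (repr hθ x) = x :=
  (exists_degree_lt_aeval hθ x).choose_spec.2

theorem repr_eq {x : L} {p : K[X]} (hp : p.degree < (minpoly K θ).degree) (hx : aeval θ p = x) :
    repr hθ x = p := by
  rw [← sub_eq_zero]
  refine eq_zero_of_dvd_of_degree_lt (p := minpoly K θ) ?_
    ((degree_sub_le _ _).trans_lt (max_lt (degree_repr_lt hθ x) hp))
  exact minpoly.dvd _ _ (by rw [map_sub, aeval_repr, hx, sub_self])

theorem repr_ne_zero (x : Lˣ) : repr hθ (x : L) ≠ 0 := fun h => by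
  have := aeval_repr hθ (x : L)
  rw [h, map_zero] at this
  exact x.ne_zero this.symm

/-- A nonzero polynomial as a unit of the field of rational functions. -/
def ratUnit {p : K[X]} (hp : p ≠ 0) : (RatFunc K)ˣ :=
  Units.mk0 (algebraMap K[X] (RatFunc K) p) (by simpa using hp)

/-- The rational function of least degree that represents a unit of `L = K(θ)`. -/
def reprUnit (x : Lˣ) : (RatFunc K)ˣ := ratUnit (repr_ne_zero hθ x)

theorem aeval_ratFunc_X (p : K[X]) :
    aeval (RatFunc.X : RatFunc K) p = algebraMap K[X] (RatFunc K) p := by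
  rw [← RatFunc.algebraMap_X, aeval_algebraMap_apply, aeval_X_left_apply]

theorem ratUnit_mem_linearUnits {p : K[X]} (hp : p ≠ 0) (h : p.Splits) :
    ratUnit hp ∈ linearUnits K (RatFunc.X : RatFunc K) :=
  mem_linearUnits_of_splits h (aeval_ratFunc_X p).symm

variable (θ) in
theorem minpoly_ne_zero' : minpoly K θ ≠ 0 :=
  minpoly.ne_zero (Algebra.IsIntegral.isIntegral θ)

variable (hs : ∀ p : K[X], p.natDegree < Module.finrank K L → p.Splits)

omit [FiniteDimensional K L] in
include hθ hs in
theorem splits_of_degree_lt {p : K[X]} (hp : p.degree < (minpoly K θ).degree) : p.Splits := by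
  rcases eq_or_ne p 0 with rfl | h0
  · exact Splits.zero
  · refine hs p ?_
    rw [← hθ]
    exact natDegree_lt_natDegree h0 hp

include hθ hs in
theorem reprUnit_mem_linearUnits (x : Lˣ) :
    reprUnit hθ x ∈ linearUnits K (RatFunc.X : RatFunc K) :=
  ratUnit_mem_linearUnits _ (splits_of_degree_lt hθ hs (degree_repr_lt hθ _))

include hθ hs in
theorem linearUnits_eq_top : linearUnits K θ = ⊤ := by
  rw [eq_top_iff]
  intro u _
  exact mem_linearUnits_of_splits (splits_of_degree_lt hθ hs (degree_repr_lt hθ (u : L)))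
    (aeval_repr hθ (u : L)).symm

variable {ℓ : ℕ} {n : ℕ}

include hθ hs in
-- This is the multiplicativity needed for `bassTate`. Let f, g, r represent x, y, xy and write fg =
-- r + Pq. If q ≠ 0, the Steinberg relation for Pq/(fg) + r/(fg) = 1 replaces P by (q/(fg))⁻¹. All
-- entries are then products of constants and linear polynomials, so reciprocity applies.
theorem residueSum_mul_reprUnit (x y : Lˣ) (b : Fin n → (RatFunc K)ˣ)
    (hb : ∀ i, b i ∈ linearUnits K (RatFunc.X : RatFunc K)) :
    residueSum (ℓ := ℓ) (n + 1) (mul (ratUnit (minpoly_ne_zero' θ))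
      (mul (reprUnit hθ (x * y) / (reprUnit hθ x * reprUnit hθ y)) (symbol ℓ b))) = 0 := by
  have hP : (minpoly K θ).Monic := minpoly.monic (Algebra.IsIntegral.isIntegral θ)
  set f := repr hθ (x : L)
  set g := repr hθ (y : L)
  have hf0 : f ≠ 0 := repr_ne_zero hθ x
  have hg0 : g ≠ 0 := repr_ne_zero hθ y
  have hh : repr hθ ((x * y : Lˣ) : L) = (f * g) %ₘ (minpoly K θ) := by
    refine repr_eq hθ (degree_modByMonic_lt _ hP) ?_
    rw [minpoly.aeval_modByMonic_minpoly, map_mul, aeval_repr, aeval_repr, Units.val_mul]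
  have hdiv := modByMonic_add_div (f * g) (minpoly K θ)
  rw [← hh] at hdiv
  have hz : ((reprUnit hθ (x * y) / (reprUnit hθ x * reprUnit hθ y) : (RatFunc K)ˣ) : RatFunc K) =
      algebraMap K[X] (RatFunc K) (repr hθ ((x * y : Lˣ) : L)) /
        algebraMap K[X] (RatFunc K) (f * g) := by
    rw [map_mul]
    push_cast
    rfl
  have hfg : algebraMap K[X] (RatFunc K) (f * g) ≠ 0 := by
    simpa using ⟨hf0, hg0⟩
  rcases eq_or_ne ((f * g) /ₘ (minpoly K θ)) 0 with hq | hq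
  · rw [hq, mul_zero, add_zero] at hdiv
    have : reprUnit hθ (x * y) / (reprUnit hθ x * reprUnit hθ y) = 1 :=
      Units.ext (by rw [hz, hdiv, div_self hfg, Units.val_one])
    rw [this, mul_unit_one, map_zero, map_zero]
  · have hqs : ((f * g) /ₘ (minpoly K θ)).Splits := by
      refine splits_of_degree_lt hθ hs ?_
      -- With d = deg P, the quotient has degree at most 2(d - 1) - d < d.
      refine degree_lt_degree ?_
      have h1 := natDegree_lt_natDegree hf0 (degree_repr_lt hθ (x : L))
      have h2 := natDegree_lt_natDegree hg0 (degree_repr_lt hθ (y : L))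
      rw [natDegree_divByMonic _ hP, natDegree_mul hf0 hg0]
      omega
    have hst : ((ratUnit (minpoly_ne_zero' θ) * (ratUnit hq / (reprUnit hθ x * reprUnit hθ y)) :
        (RatFunc K)ˣ) : RatFunc K) +
        ((reprUnit hθ (x * y) / (reprUnit hθ x * reprUnit hθ y) : (RatFunc K)ˣ) : RatFunc K) =
        1 := by
      rw [hz]
      push_cast
      change algebraMap K[X] (RatFunc K) (minpoly K θ) *
        (algebraMap K[X] (RatFunc K) ((f * g) /ₘ minpoly K θ) /
        (algebraMap K[X] (RatFunc K) f * algebraMap K[X] (RatFunc K) g)) + _ = 1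
      rw [← map_mul (algebraMap K[X] (RatFunc K)) f, ← mul_div_assoc, ← add_div,
        div_eq_one_iff_eq hfg, ← map_mul, ← map_add, add_comm, ← Units.val_mul, hdiv]
    have h := mul_mul_eq_zero hst (symbol ℓ b)
    rw [mul_mul] at h
    rw [eq_neg_of_add_eq_zero_left h, map_neg, neg_eq_zero, mul_symbol, mul_symbol]
    have hx := reprUnit_mem_linearUnits hθ hs
    refine residueSum_symbol _ fun i => ?_
    refine Fin.cases ?_ (fun i => ?_) i
    · exact div_mem (ratUnit_mem_linearUnits hq hqs) (mul_mem (hx x) (hx y))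
    · refine Fin.cases ?_ (fun i => ?_) i
      · exact div_mem (hx _) (mul_mem (hx x) (hx y))
      · exact hb i

theorem reprUnit_update (a : Fin (n + 1) → Lˣ) (i : Fin (n + 1)) (x : Lˣ) :
    (fun k => reprUnit hθ (Function.update a i x k)) =
      Function.update (fun k => reprUnit hθ (a k)) i (reprUnit hθ x) := by
  funext k
  rcases eq_or_ne k i with rfl | h
  · simp
  · simp [h]

variable (ℓ n) in
/-- The transfer of Bass and Tate: the negative of the sum of all residues of degree one of
`{P, p₁, …, pₙ}`, where `P` is the minimal polynomial of `θ` and the `pᵢ` are polynomials of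
lower degree. -/
def bassTate : MilnorKMod ℓ L (n + 1) →+ MilnorKMod ℓ K (n + 1) :=
  lift ℓ (fun a => -residueSum (n + 1) (mul (ratUnit (minpoly_ne_zero' θ))
      (symbol ℓ fun k => reprUnit hθ (a k))))
    (fun a i x y => by
      simp only [reprUnit_update, symbol_update, map_zsmul]
      rw [← neg_add, ← smul_add]
      congr 2
      have := residueSum_mul_reprUnit (ℓ := ℓ) hθ hs x y
        (i.removeNth fun k => reprUnit hθ (a k))
        (fun j => reprUnit_mem_linearUnits hθ hs _)
      simp only [mul_unit_div, mul_mul, map_sub, map_add] at this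
      rw [← map_add] at this
      rw [← map_add]
      exact sub_eq_zero.1 this)
    (fun a i j hij h => by
      rw [symbol_eq_zero (fun k => reprUnit hθ (a k)) i j hij, map_zero, map_zero, neg_zero]
      change algebraMap K[X] (RatFunc K) _ + algebraMap K[X] (RatFunc K) _ = 1
      rw [← map_add, ← map_one (algebraMap K[X] (RatFunc K))]
      congr 1
      -- Representatives are unique below the degree of P, so those of two elements with sum 1 add
      -- up to 1 already as polynomials.
      have h1 : repr hθ (1 : L) = 1 := repr_eq hθ (by
        rw [degree_one, ← natDegree_pos_iff_degree_pos, hθ]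
        exact Module.finrank_pos) (map_one _)
      rw [← h1]
      refine (repr_eq hθ ((degree_add_le _ _).trans_lt
        (max_lt (degree_repr_lt hθ _) (degree_repr_lt hθ _))) ?_).symm
      rw [map_add, aeval_repr, aeval_repr, h])
    nsmul_eq_zero

end transfer

/-! ### The Bass–Tate map satisfies the norm formula. -/

section transfer

variable {K L : Type u} [Field K] [Field L] [Algebra K L]

theorem mul_norm_algebraMap {ℓ : ℕ} (hfin : Module.finrank K L = ℓ) (a : Kˣ) {n : ℕ}
    (y : MilnorKMod ℓ K n) :
    mul (Units.map (Algebra.norm K : L →* K) (Units.map (algebraMap K L : K →* L) a)) y = 0 := by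
  have : Units.map (Algebra.norm K : L →* K) (Units.map (algebraMap K L : K →* L) a) = a ^ ℓ := by
    ext
    simp [Algebra.norm_algebraMap, hfin]
  rw [this, mul_unit_pow, nsmul_eq_zero]

/-- A homomorphism with `tr {b, a₂, …, aₙ} = {N b, a₂, …, aₙ}` is a transfer. -/
theorem isTransfer_of_mul_incl {ℓ n : ℕ} (hfin : Module.finrank K L = ℓ)
    {f : MilnorKMod ℓ L (n + 1) →+ MilnorKMod ℓ K (n + 1)}
    (hf : ∀ (b : Lˣ) (y : MilnorKMod ℓ K n), f (mul b (incl ℓ K L n y)) =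
      mul (Units.map (Algebra.norm K : L →* K) b) y) : IsTransfer f where
  map_incl x := by
    rw [hfin, nsmul_eq_zero]
    refine DFunLike.congr_fun (f := f.comp (incl ℓ K L (n + 1))) (g := 0) (hom_ext fun a => ?_) x
    rw [AddMonoidHom.comp_apply, symbol_eq_mul, incl_mul, hf, mul_norm_algebraMap hfin]
    rfl
  map_symbol_update a j b := by
    have : incl ℓ K L n (symbol ℓ (j.removeNth a)) =
        symbol ℓ (j.removeNth fun k => Units.map (algebraMap K L : K →* L) (a k)) :=
      map_symbol _ _ _
    rw [symbol_update, symbol_update, map_zsmul, ← this, hf]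

theorem IsTransfer.mul_incl {ℓ n : ℕ} {f : MilnorKMod ℓ L (n + 1) →+ MilnorKMod ℓ K (n + 1)}
    (hf : IsTransfer f) (b : Lˣ) (y : MilnorKMod ℓ K n) : f (mul b (incl ℓ K L n y)) =
      mul (Units.map (Algebra.norm K : L →* K) b) y := by
  have : f.comp ((mul b).comp (incl ℓ K L n)) =
      mul (Units.map (Algebra.norm K : L →* K) b) := hom_ext fun a => by
    have h := hf.map_symbol_update (Fin.cons 1 a) 0 b
    rw [Fin.update_cons_zero] at h
    simp only [AddMonoidHom.comp_apply, incl, map_symbol, mul_symbol]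
    rw [← h]
    congr 2
    funext k
    refine Fin.cases ?_ (fun i => ?_) k <;> simp
  exact DFunLike.congr_fun this y

variable [FiniteDimensional K L] {θ : L}
  (hθ : (minpoly K θ).natDegree = Module.finrank K L)
  (hs : ∀ p : K[X], p.natDegree < Module.finrank K L → p.Splits)
  {ℓ : ℕ} {n : ℕ} (hfin : Module.finrank K L = ℓ)

theorem reprUnit_val {x : Lˣ} {p : K[X]} (hp : p.degree < (minpoly K θ).degree)
    (hx : aeval θ p = x) :
    (reprUnit hθ x : RatFunc K) = algebraMap K[X] (RatFunc K) p := by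
  change algebraMap K[X] (RatFunc K) _ = _
  rw [repr_eq hθ hp hx]

theorem reprUnit_algebraMap (c : Kˣ) :
    reprUnit hθ (Units.map (algebraMap K L : K →* L) c) =
      Units.map (algebraMap K (RatFunc K) : K →* RatFunc K) c := by
  ext
  rw [reprUnit_val hθ (p := C (c : K)) (degree_C_le.trans_lt ?_) (by simp)]
  · exact (algebraMap_eq_algebraMap_C _).symm
  · rw [← natDegree_pos_iff_degree_pos, hθ]
    exact Module.finrank_pos

theorem bassTate_mul_incl (b : Lˣ) (y : MilnorKMod ℓ K n) :
    bassTate hθ hs ℓ n (mul b (incl ℓ K L n y)) =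
      -residueSum (n + 1) (mul (ratUnit (minpoly_ne_zero' θ))
        (mul (reprUnit hθ b) (incl ℓ K (RatFunc K) n y))) := by
  have : (bassTate hθ hs ℓ n).comp ((mul b).comp (incl ℓ K L n)) =
      -((residueSum (n + 1)).comp ((mul (ratUnit (minpoly_ne_zero' θ))).comp
        ((mul (reprUnit hθ b)).comp (incl ℓ K (RatFunc K) n)))) := hom_ext fun a => by
    simp only [AddMonoidHom.comp_apply, AddMonoidHom.neg_apply, incl, map_symbol, mul_symbol,
      bassTate, lift_symbol]
    congr 5
    funext k
    refine Fin.cases rfl (fun i => ?_) k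
    simp only [Fin.cons_succ]
    exact reprUnit_algebraMap hθ _
  exact DFunLike.congr_fun this y

theorem placeInf_minpoly {p : (RatFunc K)ˣ}
    (hp : (p : RatFunc K) = algebraMap K[X] (RatFunc K) (minpoly K θ)) :
    (placeInf K p).order = -(minpoly K θ).natDegree ∧ (placeInf K p).leadingCoeff = 1 := by
  have h := placeInf_algebraMap_order (minpoly_ne_zero' (K := K) θ)
  rw [← hp, minpoly.monic (Algebra.IsIntegral.isIntegral θ)] at h
  exact h

include hθ in
theorem eval_minpoly_ne_zero (h2 : 2 ≤ Module.finrank K L) (c : K) :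
    (minpoly K θ).eval c ≠ 0 := by
  intro h
  have hirr := minpoly.irreducible (Algebra.IsIntegral.isIntegral (R := K) θ)
  have := natDegree_eq_of_degree_eq_some (degree_eq_one_of_irreducible_of_root hirr h)
  have h1 : Module.finrank K L = 1 := hθ ▸ this
  omega

include hθ hfin in
-- Infinity contributes nothing: P is monic of degree ℓ.
theorem residueSum_minpoly_mul {f : (RatFunc K)ˣ} (z : MilnorKMod ℓ (RatFunc K) n) :
    residueSum (n + 1) (mul (ratUnit (minpoly_ne_zero' (K := K) θ)) (mul f z)) =
      ∑ᶠ c : K, residueAt c (n + 1)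
        (mul (ratUnit (minpoly_ne_zero' (K := K) θ)) (mul f z)) := by
  have h := placeInf_minpoly (K := K) (θ := θ) (p := ratUnit (minpoly_ne_zero' θ)) rfl
  have hd : (ℓ : ℤ) ∣ -((minpoly K θ).natDegree : ℤ) := by rw [hθ, hfin, dvd_neg]
  rw [residueSum_apply, placeAct_mul_of_dvd (placeInf K) hd h.1 h.2, Prod.snd_zero,
    Pi.zero_apply, zero_add]

include hθ in
-- P is irreducible of degree at least 2, hence a unit at every rational c, with residue P(c). The
-- minus sign comes from moving the residue past {P}, and it is why `bassTate` carries a sign.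
theorem residueAt_minpoly_mul_incl (h2 : 2 ≤ Module.finrank K L) (c : K) {f : (RatFunc K)ˣ}
    {i : ℤ} (hi : (placeAt c (f : RatFunc K)).order = i) (y : MilnorKMod ℓ K n) :
    residueAt c (n + 1) (mul (ratUnit (minpoly_ne_zero' (K := K) θ))
      (mul f (incl ℓ K (RatFunc K) n y))) =
      -(i • mul (Units.mk0 _ (eval_minpoly_ne_zero hθ h2 c)) y) := by
  have h := placeAt_of_eval_ne_zero (eval_minpoly_ne_zero hθ h2 c)
  have h1 : (placeAt c (ratUnit (minpoly_ne_zero' (K := K) θ) : RatFunc K)).order = 0 := h.1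
  have h3 : (placeAt c (ratUnit (minpoly_ne_zero' (K := K) θ) : RatFunc K)).leadingCoeff =
    (Units.mk0 _ (eval_minpoly_ne_zero hθ h2 c) : Kˣ) := h.2
  have hw : (placeAt c (f : RatFunc K)).leadingCoeff ≠ 0 :=
    HahnSeries.leadingCoeff_ne_zero.2 ((_root_.map_ne_zero _).2 f.ne_zero)
  have h4 : (placeAt c (f : RatFunc K)).leadingCoeff = (Units.mk0 _ hw : Kˣ) := rfl
  change (placeAct ℓ (placeAt c) (n + 2) _).2 (n + 1) = _
  exact placeAct_mul_mul_incl (placeAt c) (placeAt_const c) h1 h3 hi h4 y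

include hfin in
theorem bassTate_mul_incl_algebraMap (h2 : 2 ≤ Module.finrank K L) (a : Kˣ)
    (y : MilnorKMod ℓ K n) :
    bassTate hθ hs ℓ n (mul (Units.map (algebraMap K L : K →* L) a) (incl ℓ K L n y)) = 0 := by
  rw [bassTate_mul_incl, residueSum_minpoly_mul hθ hfin, neg_eq_zero, ← finsum_zero]
  congr 1
  funext c
  rw [residueAt_minpoly_mul_incl hθ h2 c (i := 0)]
  · simp
  · rw [reprUnit_algebraMap]
    simp only [Units.coe_map, MonoidHom.coe_coe, placeAt_const]
    simp

include hfin in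
theorem bassTate_mul_incl_linear (h2 : 2 ≤ Module.finrank K L) {b : Lˣ} {d : K}
    (hb : (b : L) = θ - algebraMap K L d) (y : MilnorKMod ℓ K n) :
    bassTate hθ hs ℓ n (mul b (incl ℓ K L n y)) =
      mul (Units.mk0 _ (eval_minpoly_ne_zero hθ h2 d)) y := by
  have hr : (reprUnit hθ b : RatFunc K) = algebraMap K[X] (RatFunc K) (X - C d) := by
    refine reprUnit_val hθ ?_ (by simp [hb])
    refine degree_lt_degree ?_
    rw [natDegree_X_sub_C, hθ]
    omega
  rw [bassTate_mul_incl, residueSum_minpoly_mul hθ hfin, finsum_eq_single _ d]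
  · rw [residueAt_minpoly_mul_incl hθ h2 d (i := 1)
      (by rw [hr]; exact (placeAt_X_sub_C_self d).1), neg_neg, one_zsmul]
  · intro c hc
    rw [residueAt_minpoly_mul_incl hθ h2 c (i := 0), zero_zsmul, neg_zero]
    rw [hr]
    exact (placeAt_of_eval_ne_zero (by simpa [sub_eq_zero] using hc)).1

include hfin in
theorem bassTate_mul_incl_eq_norm (h2 : 2 ≤ Module.finrank K L) (b : Lˣ)
    (y : MilnorKMod ℓ K n) :
    bassTate hθ hs ℓ n (mul b (incl ℓ K L n y)) =
      mul (Units.map (Algebra.norm K : L →* K) b) y := by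
  have hb : b ∈ linearUnits K θ := linearUnits_eq_top hθ hs ▸ Subgroup.mem_top b
  induction hb using Subgroup.closure_induction with
  | one => simp
  | mul a b _ _ ha hb => rw [mul_mul, map_add, map_mul, mul_mul, ha, hb]
  | inv a _ ha => rw [mul_unit_inv, map_neg, map_inv, mul_unit_inv, ha]
  | mem g hg =>
    rcases hg with ⟨c, hc⟩ | ⟨c, hc⟩
    · have hc0 : c ≠ 0 := by
        rintro rfl
        exact g.ne_zero (by rw [hc, map_zero])
      obtain rfl : g = Units.map (algebraMap K L : K →* L) (Units.mk0 c hc0) := Units.ext hc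
      rw [bassTate_mul_incl_algebraMap hθ hs hfin h2, mul_norm_algebraMap hfin]
    · rw [bassTate_mul_incl_linear hθ hs hfin h2 hc]
      -- The norm of θ - c is (-1)^ℓ P(c); the sign is an ℓ-th power, so it disappears modulo ℓ.
      have : Units.map (Algebra.norm K : L →* K) g =
          (-1) ^ ℓ * Units.mk0 _ (eval_minpoly_ne_zero hθ h2 c) := by
        ext
        simp only [Units.coe_map, Units.val_mul, Units.val_pow_eq_pow_val,
          Units.val_neg, Units.val_one, Units.val_mk0]
        rw [← norm_algebraMap_sub hθ c, hc, ← neg_sub, ← neg_one_mul, map_mul]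
        congr 1
        have := Algebra.norm_algebraMap (S := L) (-1 : K)
        rw [hfin, map_neg, map_one] at this
        exact this
      rw [this, mul_mul, mul_unit_pow, nsmul_eq_zero, zero_add]

include hs in
/-- The transfer of Bass and Tate exists and is unique in degree `ℓ`. -/
theorem transfer_isTransfer (hθ : (minpoly K θ).natDegree = Module.finrank K L)
    (hℓ : 2 ≤ ℓ) (hfin : Module.finrank K L = ℓ) (n : ℕ) :
    IsTransfer (transfer ℓ K L (n + 1)) := by
  have h : ∃! f : MilnorKMod ℓ L (n + 1) →+ MilnorKMod ℓ K (n + 1), IsTransfer f := by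
    refine ⟨bassTate hθ hs ℓ n, isTransfer_of_mul_incl hfin
      (bassTate_mul_incl_eq_norm hθ hs hfin (hfin ▸ hℓ)), fun g hg => ?_⟩
    refine hom_ext_of_linearUnits (linearUnits_eq_top hθ hs) fun b y => ?_
    rw [hg.mul_incl, bassTate_mul_incl_eq_norm hθ hs hfin (hfin ▸ hℓ)]
  rw [transfer, dif_pos h]
  exact h.choose_spec.1

end transfer

end MilnorKMod

/-! ### Fields without finite extensions of degree prime to `ℓ` -/

namespace NoPrimeToExtensions

open Polynomial

variable {ℓ : ℕ} {F : Type u} [Field F]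

/-- In characteristic p ≠ ℓ, an element without p-th root would yield an extension of degree p,
prime to ℓ. -/
theorem perfectField (hF : NoPrimeToExtensions ℓ F) (hchar : (ℓ : F) ≠ 0) (hℓ : ℓ.Prime) :
    PerfectField F := by
  obtain ⟨p, hp⟩ := ExpChar.exists F
  rcases hp with _ | hp
  · infer_instance
  · have hpp : p.Prime := by assumption
    have : Fact p.Prime := ⟨hpp⟩
    have : ExpChar F p := ExpChar.prime hpp
    have hcop : p.Coprime ℓ := (Nat.coprime_primes hpp hℓ).2 (by
      rintro rfl
      exact hchar (CharP.cast_eq_zero F p))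
    have : PerfectRing F p := PerfectRing.ofSurjective F p fun a => by
      by_contra! h
      have hirr : Irreducible (X ^ p - C a) := X_pow_sub_C_irreducible_of_prime hpp h
      have : Fact (Irreducible (X ^ p - C a)) := ⟨hirr⟩
      have hfin : FiniteDimensional F (AdjoinRoot (X ^ p - C a)) :=
        (AdjoinRoot.powerBasis hirr.ne_zero).finite
      have hdeg : Module.finrank F (AdjoinRoot (X ^ p - C a)) = p := by
        rw [(AdjoinRoot.powerBasis hirr.ne_zero).finrank, AdjoinRoot.powerBasis_dim,
          natDegree_X_pow_sub_C]
      have := hF (AdjoinRoot (X ^ p - C a)) (by rwa [hdeg])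
      exact hpp.one_lt.ne' (hdeg.symm.trans this)
    exact PerfectRing.toPerfectField F p

/-- In the normal closure, the fixed field of a Sylow ℓ-subgroup has degree prime to ℓ over F, so it
is F and the Galois group is an ℓ-group. -/
theorem exists_finrank_eq_pow (hF : NoPrimeToExtensions ℓ F) (hchar : (ℓ : F) ≠ 0)
    (hℓ : ℓ.Prime) (M : Type u) [Field M] [Algebra F M] [FiniteDimensional F M] :
    ∃ k, Module.finrank F M = ℓ ^ k := by
  have := hF.perfectField hchar hℓ
  have : Fact ℓ.Prime := ⟨hℓ⟩
  let N := IntermediateField.normalClosure F M (AlgebraicClosure M)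
  have : IsGalois F (AlgebraicClosure M) :=
    { to_normal := by
        have : Algebra.IsAlgebraic F (AlgebraicClosure M) := Algebra.IsAlgebraic.trans F M _
        have : IsAlgClosure F (AlgebraicClosure M) := ⟨inferInstance, this⟩
        exact IsAlgClosure.normal F _
      to_isSeparable := by
        have : Algebra.IsAlgebraic F (AlgebraicClosure M) := Algebra.IsAlgebraic.trans F M _
        infer_instance }
  have hgal : IsGalois F N := IsGalois.normalClosure F M _
  let H : Sylow ℓ (N ≃ₐ[F] N) := default
  have hindex : (H : Subgroup (N ≃ₐ[F] N)).index = 1 := by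
    rw [← IntermediateField.fixingSubgroup_fixedField (H : Subgroup (N ≃ₐ[F] N)),
      ← IntermediateField.finrank_eq_fixingSubgroup_index]
    refine hF _ ?_
    rw [IntermediateField.finrank_eq_fixingSubgroup_index,
      IntermediateField.fixingSubgroup_fixedField]
    exact ((Nat.Prime.coprime_iff_not_dvd hℓ).2 H.not_dvd_index).symm
  have hcard : Nat.card (N ≃ₐ[F] N) = Nat.card (H : Subgroup (N ≃ₐ[F] N)) := by
    rw [← (H : Subgroup (N ≃ₐ[F] N)).card_mul_index, hindex, mul_one]
  obtain ⟨k, hk⟩ := IsPGroup.iff_card.1 H.isPGroup'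
  have hdvd : Module.finrank F M ∣ ℓ ^ k := by
    rw [← hk, ← hcard, IsGalois.card_aut_eq_finrank, ← Module.finrank_mul_finrank F M N]
    exact dvd_mul_right _ _
  obtain ⟨j, -, hj⟩ := (Nat.dvd_prime_pow hℓ).1 hdvd
  exact ⟨j, hj⟩

/-- An irreducible factor over K generates a finite extension of F, so its degree divides a power of
ℓ; being less than ℓ, it is 1. -/
theorem splits (hF : NoPrimeToExtensions ℓ F) (hchar : (ℓ : F) ≠ 0) (hℓ : ℓ.Prime)
    {K : Type u} [Field K] [Algebra F K] [FiniteDimensional F K] (p : K[X])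
    (hp : p.natDegree < ℓ) : p.Splits := by
  have hirr : ∀ g : K[X], Irreducible g → g.natDegree < ℓ → g.natDegree = 1 := fun g hg hgℓ => by
    have : Fact (Irreducible g) := ⟨hg⟩
    have hfin : FiniteDimensional K (AdjoinRoot g) := (AdjoinRoot.powerBasis hg.ne_zero).finite
    have hdeg : Module.finrank K (AdjoinRoot g) = g.natDegree := by
      rw [(AdjoinRoot.powerBasis hg.ne_zero).finrank, AdjoinRoot.powerBasis_dim]
    have : FiniteDimensional F (AdjoinRoot g) := FiniteDimensional.trans F K _
    obtain ⟨k, hk⟩ := hF.exists_finrank_eq_pow hchar hℓ (AdjoinRoot g)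
    have hdvd : g.natDegree ∣ ℓ ^ k := by
      rw [← hk, ← hdeg, ← Module.finrank_mul_finrank F K (AdjoinRoot g)]
      exact dvd_mul_left _ _
    obtain ⟨j, -, hj⟩ := (Nat.dvd_prime_pow hℓ).1 hdvd
    rw [hj] at hgℓ ⊢
    rcases j with _ | j
    · rfl
    · exact absurd hgℓ (not_lt.2 (Nat.le_self_pow (by simp) ℓ))
  induction h : p.natDegree using Nat.strong_induction_on generalizing p with
  | _ d ih =>
    rcases Nat.eq_zero_or_pos p.natDegree with h0 | h0
    · exact Splits.of_natDegree_eq_zero h0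
    · have hp0 : p ≠ 0 := by
        rintro rfl
        simp at h0
      obtain ⟨g, hg, q, rfl⟩ := exists_irreducible_of_natDegree_pos h0
      have hq0 : q ≠ 0 := right_ne_zero_of_mul hp0
      rw [natDegree_mul hg.ne_zero hq0] at hp h
      have hg1 := hirr g hg (by omega)
      exact (Splits.of_natDegree_eq_one hg1).mul (ih q.natDegree (by omega) q (by omega) rfl)

/-- Dividing the minimal polynomial of x by X - x over E leaves degree less than ℓ, so the rest
splits too. Separability follows from perfectness. -/
theorem isGalois (hF : NoPrimeToExtensions ℓ F) (hchar : (ℓ : F) ≠ 0) (hℓ : ℓ.Prime)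
    {E : Type u} [Field E] [Algebra F E] [FiniteDimensional F E] (hE : Module.finrank F E = ℓ) :
    IsGalois F E := by
  have := hF.perfectField hchar hℓ
  have hn : Normal F E := by
    refine normal_iff.2 fun x => ?_
    have hx : IsIntegral F x := Algebra.IsIntegral.isIntegral x
    refine ⟨hx, ?_⟩
    have hd := minpoly.degree_dvd hx
    rw [hE] at hd
    have hm0 : (minpoly F x).map (algebraMap F E) ≠ 0 :=
      Polynomial.map_ne_zero (minpoly.ne_zero hx)
    have hroot : ((minpoly F x).map (algebraMap F E)).IsRoot x := by
      rw [IsRoot, eval_map_algebraMap, minpoly.aeval]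
    obtain ⟨q, hq⟩ := dvd_iff_isRoot.2 hroot
    have hq0 : q ≠ 0 := by
      rintro rfl
      exact hm0 (by rw [hq, mul_zero])
    rw [hq]
    refine (Splits.X_sub_C x).mul (hF.splits hchar hℓ q ?_)
    have h1 : ((minpoly F x).map (algebraMap F E)).natDegree = 1 + q.natDegree := by
      rw [hq, natDegree_mul (X_sub_C_ne_zero x) hq0, natDegree_X_sub_C]
    rw [natDegree_map] at h1
    have h2 := Nat.le_of_dvd hℓ.pos hd
    omega
  exact { to_normal := hn, to_isSeparable := inferInstance }

end NoPrimeToExtensions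

theorem natDegree_minpoly_of_prime {K L : Type*} [Field K] [Field L] [Algebra K L]
    [FiniteDimensional K L] (hp : (Module.finrank K L).Prime) {x : L}
    (hx : x ∉ (algebraMap K L).range) : (minpoly K x).natDegree = Module.finrank K L := by
  have hi : IsIntegral K x := Algebra.IsIntegral.isIntegral x
  rcases (Nat.dvd_prime hp).1 (minpoly.degree_dvd hi) with h | h
  · exact absurd (minpoly.natDegree_eq_one_iff.1 h) hx
  · exact h

theorem exists_natDegree_minpoly_eq_of_prime {K L : Type*} [Field K] [Field L] [Algebra K L]
    [FiniteDimensional K L] (hp : (Module.finrank K L).Prime) :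
    ∃ x : L, (minpoly K x).natDegree = Module.finrank K L := by
  by_contra! h
  have hs : Function.Surjective (algebraMap K L) := fun x => by
    by_contra hx
    exact h x (natDegree_minpoly_of_prime hp hx)
  have h1 : Module.finrank K L = 1 := by
    rw [← Module.finrank_self K]
    exact (LinearEquiv.ofBijective (Algebra.linearMap K L)
      ⟨(algebraMap K L).injective, hs⟩).finrank_eq.symm
  exact hp.ne_one h1

namespace MilnorKMod

open Polynomial

/-! ### Functorial properties of the transfer -/

/-- `L / K` is an extension of degree `ℓ` and polynomials of degree less than `ℓ` split over `K`. -/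
structure IsBassTate (ℓ : ℕ) (K L : Type u) [Field K] [Field L] [Algebra K L] : Prop where
  prime : ℓ.Prime
  finrank_eq : Module.finrank K L = ℓ
  splits : ∀ p : K[X], p.natDegree < ℓ → p.Splits

namespace IsBassTate

variable {ℓ : ℕ} {K L : Type u} [Field K] [Field L] [Algebra K L]

theorem finiteDimensional (h : IsBassTate ℓ K L) : FiniteDimensional K L :=
  FiniteDimensional.of_finrank_pos (h.finrank_eq ▸ h.prime.pos)

theorem exists_generator (h : IsBassTate ℓ K L) :
    ∃ θ : L, (minpoly K θ).natDegree = Module.finrank K L := by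
  have := h.finiteDimensional
  exact exists_natDegree_minpoly_eq_of_prime (h.finrank_eq ▸ h.prime)

theorem isTransfer (h : IsBassTate ℓ K L) (n : ℕ) : IsTransfer (transfer ℓ K L (n + 1)) := by
  have := h.finiteDimensional
  obtain ⟨θ, hθ⟩ := h.exists_generator
  exact transfer_isTransfer (h.finrank_eq ▸ h.splits) hθ h.prime.two_le h.finrank_eq n

theorem transfer_mul_incl (h : IsBassTate ℓ K L) {n : ℕ} (b : Lˣ) (y : MilnorKMod ℓ K n) :
    transfer ℓ K L (n + 1) (mul b (incl ℓ K L n y)) =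
      mul (Units.map (Algebra.norm K : L →* K) b) y := (h.isTransfer n).mul_incl b y

theorem transfer_incl (h : IsBassTate ℓ K L) {n : ℕ} (y : MilnorKMod ℓ K (n + 1)) :
    transfer ℓ K L (n + 1) (incl ℓ K L (n + 1) y) = 0 := by
  rw [(h.isTransfer n).map_incl, h.finrank_eq, nsmul_eq_zero]

theorem hom_ext (h : IsBassTate ℓ K L) {n : ℕ} {A : Type*} [AddCommGroup A]
    {f g : MilnorKMod ℓ L (n + 1) →+ A}
    (hfg : ∀ (b : Lˣ) (y : MilnorKMod ℓ K n),
      f (mul b (incl ℓ K L n y)) = g (mul b (incl ℓ K L n y))) : f = g := by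
  have := h.finiteDimensional
  obtain ⟨θ, hθ⟩ := h.exists_generator
  exact hom_ext_of_linearUnits (linearUnits_eq_top hθ (h.finrank_eq ▸ h.splits)) hfg

theorem map_incl_eq {K' L' : Type u} [Field K'] [Field L'] [Algebra K' L'] {φ : K →+* K'}
    {ψ : L →+* L'} (hc : ∀ c : K, ψ (algebraMap K L c) = algebraMap K' L' (φ c)) {n : ℕ}
    (y : MilnorKMod ℓ K n) :
    map ℓ ψ n (incl ℓ K L n y) = incl ℓ K' L' n (map ℓ φ n y) := by
  have : ψ.comp (algebraMap K L) = (algebraMap K' L').comp φ := RingHom.ext hc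
  rw [incl, incl, map_map, map_map, this]

/-- The transfer is compatible with homomorphisms of extensions that are compatible with norms. -/
theorem transfer_map (h : IsBassTate ℓ K L) {K' L' : Type u} [Field K'] [Field L'] [Algebra K' L']
    (h' : IsBassTate ℓ K' L') {φ : K →+* K'} {ψ : L →+* L'}
    (hc : ∀ c : K, ψ (algebraMap K L c) = algebraMap K' L' (φ c))
    (hN : ∀ b : L, Algebra.norm K' (ψ b) = φ (Algebra.norm K b)) {n : ℕ}
    (x : MilnorKMod ℓ L (n + 1)) :
    transfer ℓ K' L' (n + 1) (map ℓ ψ (n + 1) x) =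
      map ℓ φ (n + 1) (transfer ℓ K L (n + 1) x) := by
  have : (transfer ℓ K' L' (n + 1)).comp (map ℓ ψ (n + 1)) =
      (map ℓ φ (n + 1)).comp (transfer ℓ K L (n + 1)) := h.hom_ext fun b y => by
    simp only [AddMonoidHom.comp_apply, map_mul_apply]
    rw [h.transfer_mul_incl, map_incl_eq hc, h'.transfer_mul_incl, map_mul_apply]
    congr 2
    ext
    exact hN b
  exact DFunLike.congr_fun this x

theorem map_algEquiv_incl (σ : L ≃ₐ[K] L) {n : ℕ} (y : MilnorKMod ℓ K n) :
    map ℓ (σ : L →+* L) n (incl ℓ K L n y) = incl ℓ K L n y := by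
  have : ((σ : L →+* L)).comp (algebraMap K L) = algebraMap K L := by
    ext c
    simp
  rw [incl, map_map, this]

theorem incl_norm [FiniteDimensional K L] [IsGalois K L] (b : Lˣ) :
    Units.map (algebraMap K L : K →* L) (Units.map (Algebra.norm K : L →* K) b) =
      ∏ σ : L ≃ₐ[K] L, Units.map ((σ : L →+* L) : L →* L) b := by
  ext
  rw [Units.coe_prod]
  exact Algebra.norm_eq_prod_automorphisms K (b : L)

/-- On generators with one entry outside K this says that the norm is the product of the conjugates.
-/
theorem incl_transfer [FiniteDimensional K L] [IsGalois K L] (h : IsBassTate ℓ K L) {n : ℕ}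
    (x : MilnorKMod ℓ L (n + 1)) :
    incl ℓ K L (n + 1) (transfer ℓ K L (n + 1) x) =
      ∑ σ : L ≃ₐ[K] L, map ℓ (σ : L →+* L) (n + 1) x := by
  have : (incl ℓ K L (n + 1)).comp (transfer ℓ K L (n + 1)) =
      ∑ σ : L ≃ₐ[K] L, map ℓ (σ : L →+* L) (n + 1) := h.hom_ext fun b y => by
    rw [AddMonoidHom.comp_apply, h.transfer_mul_incl, incl_mul, incl_norm, mul_unit_prod,
      AddMonoidHom.finsetSum_apply]
    refine Finset.sum_congr rfl fun σ _ => ?_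
    rw [map_mul_apply, map_algEquiv_incl]
  rw [← AddMonoidHom.comp_apply, this, AddMonoidHom.finsetSum_apply]

end IsBassTate

/-! ### Working with coinvariants on representatives. -/

section coinvariants

variable {ℓ : ℕ} {K L : Type u} [Field K] [Field L] [Algebra K L] {n : ℕ}

theorem transferCoinv_mk (x : MilnorKMod ℓ L n) :
    transferCoinv ℓ K L n (Representation.Coinvariants.mk (galRep ℓ K L n) x) =
      transfer ℓ K L n x := rfl

theorem CoinvExact.exists_sub_incl_mem_ker (h : CoinvExact ℓ K L n) {x : MilnorKMod ℓ L n}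
    (hx : transfer ℓ K L n x = 0) :
    ∃ y, x - incl ℓ K L n y ∈ Representation.Coinvariants.ker (galRep ℓ K L n) := by
  obtain ⟨y, hy⟩ := (h (Representation.Coinvariants.mk _ x)).1 hx
  exact ⟨y, (Representation.Coinvariants.mk_eq_iff _).1 hy.symm⟩

/-- A homomorphism that is invariant under the Galois group vanishes on the kernel of the
projection to the coinvariants. -/
theorem map_eq_zero_of_mem_ker {A : Type*} [AddCommGroup A] (f : MilnorKMod ℓ L n →+ A)
    (hf : ∀ (σ : L ≃ₐ[K] L) x, f (map ℓ (σ : L →+* L) n x) = f x) {x : MilnorKMod ℓ L n}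
    (hx : x ∈ Representation.Coinvariants.ker (galRep ℓ K L n)) : f x = 0 := by
  have hle : Representation.Coinvariants.ker (galRep ℓ K L n) ≤ LinearMap.ker f.toIntLinearMap := by
    refine Submodule.span_le.2 ?_
    rintro _ ⟨⟨σ, x⟩, rfl⟩
    change f (map ℓ (σ : L →+* L) n x - x) = 0
    rw [map_sub, hf, sub_self]
  exact hle hx

end coinvariants

/-! ### Norms under base change. -/

section norms

variable {F E K M : Type u} [Field F] [Field E] [Field K] [Field M] [Algebra F E] [Algebra F K]
  [Algebra E M] [Algebra K M] [Algebra F M] [IsScalarTower F E M] [IsScalarTower F K M]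

/-- An element of E outside F stays outside K, so by primality of the degree its minimal polynomial
does not change, and neither does its norm. -/
theorem norm_algebraMap_of_disjoint [FiniteDimensional F E] [FiniteDimensional K M]
    (hp : (Module.finrank F E).Prime) (hr : Module.finrank K M = Module.finrank F E)
    (hd : ∀ e : E, algebraMap E M e ∈ (algebraMap K M).range → e ∈ (algebraMap F E).range)
    (e : E) : Algebra.norm K (algebraMap E M e) = algebraMap F K (Algebra.norm F e) := by
  by_cases he : e ∈ (algebraMap F E).range
  · obtain ⟨c, rfl⟩ := he
    rw [← IsScalarTower.algebraMap_apply F E M, IsScalarTower.algebraMap_apply F K M,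
      Algebra.norm_algebraMap, Algebra.norm_algebraMap, hr, map_pow]
  -- The norm formula is for c - θ; taking θ = -e and c = 0 gives the norm of e itself.
  · have he' : -e ∉ (algebraMap F E).range := fun h => he (by simpa using neg_mem h)
    have h1 := natDegree_minpoly_of_prime hp he'
    have h2 := natDegree_minpoly_of_prime (K := K) (hr ▸ hp) (fun h => he' (hd (-e) h))
    have h3 : minpoly K (algebraMap E M (-e)) = (minpoly F (-e)).map (algebraMap F K) := by
      have hi : IsIntegral F (-e) := Algebra.IsIntegral.isIntegral _
      refine (eq_of_monic_of_dvd_of_natDegree_le (minpoly.monic (Algebra.IsIntegral.isIntegral _))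
        ((minpoly.monic hi).map _) (minpoly.dvd _ _ ?_) ?_).symm
      · rw [aeval_map_algebraMap, aeval_algebraMap_apply, minpoly.aeval, map_zero]
      · rw [natDegree_map, h1, h2, hr]
    have h4 := norm_algebraMap_sub h1 0
    have h5 := norm_algebraMap_sub h2 0
    rw [h3, ← map_zero (algebraMap F K), eval_map_apply, ← h4] at h5
    simpa using h5

end norms

/-! ### The cokernel of the inclusion into the coinvariants. -/

section coker

variable {ℓ : ℕ} (F E : Type u) [Field F] [Field E] [Algebra F E] (n : ℕ)

/-- The projection of `kₙ(E)` to the cokernel of `kₙ(F) → kₙ(E)_Σ`. -/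
def toCoker : MilnorKMod ℓ E n →+ Coinv ℓ F E n ⧸ (inclCoinv ℓ F E n).range :=
  (QuotientAddGroup.mk' _).comp (Representation.Coinvariants.mk (galRep ℓ F E n)).toAddMonoidHom

variable {F E n}

theorem toCoker_eq_zero {x : MilnorKMod ℓ E n} : toCoker F E n x = 0 ↔
    Representation.Coinvariants.mk (galRep ℓ F E n) x ∈ (inclCoinv ℓ F E n).range :=
  QuotientAddGroup.eq_zero_iff _

@[simp]
theorem toCoker_incl (y : MilnorKMod ℓ F n) : toCoker F E n (incl ℓ F E n y) = 0 :=
  toCoker_eq_zero.2 ⟨y, rfl⟩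

theorem toCoker_map (σ : E ≃ₐ[F] E) (x : MilnorKMod ℓ E n) :
    toCoker F E n (map ℓ (σ : E →+* E) n x) = toCoker F E n x :=
  congrArg (QuotientAddGroup.mk' _)
    (Representation.Coinvariants.mk_self_apply (galRep ℓ F E n) σ x)

theorem nsmul_coker_eq_zero (b : Coinv ℓ F E n ⧸ (inclCoinv ℓ F E n).range) : ℓ • b = 0 := by
  obtain ⟨b, rfl⟩ := QuotientAddGroup.mk'_surjective _ b
  obtain ⟨x, rfl⟩ := Representation.Coinvariants.mk_surjective _ b
  rw [← map_nsmul, ← map_nsmul, nsmul_eq_zero, map_zero, map_zero]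

/-- The class of `{c} α` in the cokernel of `kₙ₊₁(F) → kₙ₊₁(E)_Σ` only depends on the transfer of
`α`. -/
theorem toCoker_mul_eq_zero (hex : CoinvExact ℓ F E n) (c : Fˣ) {x : MilnorKMod ℓ E n}
    (hx : transfer ℓ F E n x = 0) :
    toCoker F E (n + 1) (mul (Units.map (algebraMap F E : F →* E) c) x) = 0 := by
  obtain ⟨y, hy⟩ := hex.exists_sub_incl_mem_ker hx
  have h := map_eq_zero_of_mem_ker
    ((toCoker F E (n + 1)).comp (mul (Units.map (algebraMap F E : F →* E) c))) (fun σ x => ?_) hy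
  · rw [map_sub, sub_eq_zero] at h
    change toCoker F E (n + 1) (mul _ x) = toCoker F E (n + 1) (mul _ (incl ℓ F E n y)) at h
    rw [h, ← incl_mul, toCoker_incl]
  · simp only [AddMonoidHom.comp_apply]
    rw [← toCoker_map σ (mul _ x), map_mul_apply]
    congr 3
    ext
    simp

end coker

/-! ### The Steinberg relation in the cokernel. -/

section steinberg

variable {ℓ : ℕ} {F E : Type u} [Field F] [Field E] [Algebra F E] {n : ℕ}

theorem minpoly_eq_X_pow_sub_C {ℓ : ℕ} (hℓ : ℓ.Prime) {a : F} (ha : Irreducible (X ^ ℓ - C a))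
    {β : E} (hβ : β ^ ℓ = algebraMap F E a) : minpoly F β = X ^ ℓ - C a :=
  (minpoly.eq_of_irreducible_of_monic ha (by simp [hβ])
    (monic_X_pow_sub_C a hℓ.ne_zero)).symm

/-- The minimal polynomial X^ℓ - a of β takes the value 1 - a = c at 1. -/
theorem exists_unit_norm_one_sub (h : IsBassTate ℓ F E) {a c : Fˣ} (hac : (c : F) + a = 1)
    (ha : Irreducible (X ^ ℓ - C (a : F))) {β : E} (hβ : β ^ ℓ = algebraMap F E a) :
    ∃ u : Eˣ, (u : E) = 1 - β ∧ Units.map (Algebra.norm F : E →* F) u = c := by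
  have := h.finiteDimensional
  have hm := minpoly_eq_X_pow_sub_C h.prime ha hβ
  have hN : Algebra.norm F (1 - β) = c := by
    have := norm_algebraMap_sub (K := F) (θ := β)
      (by rw [hm, natDegree_X_pow_sub_C, h.finrank_eq]) 1
    rw [map_one, hm] at this
    rw [this, eq_sub_of_add_eq hac]
    simp
  have h0 : 1 - β ≠ 0 := fun h0 => by
    rw [h0, Algebra.norm_zero] at hN
    exact c.ne_zero hN.symm
  exact ⟨Units.mk0 _ h0, rfl, Units.ext hN⟩

theorem incl_mul_eq_zero_of_root {a : Fˣ} (hℓ : ℓ ≠ 0) {β : E} (hβ : β ^ ℓ = algebraMap F E a)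
    (x : MilnorKMod ℓ F n) : incl ℓ F E (n + 1) (mul a x) = 0 := by
  have hβ0 : β ≠ 0 := by
    rintro rfl
    rw [zero_pow hℓ] at hβ
    exact (map_ne_zero (algebraMap F E)).2 a.ne_zero hβ.symm
  have : Units.map (algebraMap F E : F →* E) a = Units.mk0 β hβ0 ^ ℓ := by
    ext
    simp [hβ]
  rw [incl_mul, this, mul_unit_pow, nsmul_eq_zero]

/-- With u = 1 - β of norm c, the class of {c} α is the sum of those of {σu} α, hence that of {u}
times the sum of all conjugates of α, which is i(tr α) = ℓ{β} i(x) = 0. -/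
theorem toCoker_mul_eq_zero_of_root_mem [FiniteDimensional F E] [IsGalois F E]
    (h : IsBassTate ℓ F E) {a c : Fˣ} (hac : (c : F) + a = 1)
    (ha : Irreducible (X ^ ℓ - C (a : F))) {β : E} (hβ : β ^ ℓ = algebraMap F E a)
    {x : MilnorKMod ℓ F n} {α : MilnorKMod ℓ E (n + 1)}
    (hα : transfer ℓ F E (n + 1) α = mul a x) :
    toCoker F E (n + 2) (mul (Units.map (algebraMap F E : F →* E) c) α) = 0 := by
  obtain ⟨u, -, hu⟩ := exists_unit_norm_one_sub h hac ha hβ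
  rw [← hu, IsBassTate.incl_norm, mul_unit_prod, map_sum]
  -- Applying σ⁻¹ does not change the class and shifts the conjugation from u to α.
  have key : ∀ σ : E ≃ₐ[F] E, toCoker F E (n + 2)
      (mul (Units.map ((σ : E →+* E) : E →* E) u) α) =
      toCoker F E (n + 2) (mul u (map ℓ ((σ⁻¹ : E ≃ₐ[F] E) : E →+* E) (n + 1) α)) := fun σ => by
    rw [← toCoker_map σ⁻¹, map_mul_apply]
    congr 3
    ext
    exact σ.symm_apply_apply (u : E)
  have hsum : ∑ σ : E ≃ₐ[F] E, map ℓ ((σ⁻¹ : E ≃ₐ[F] E) : E →+* E) (n + 1) α =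
      ∑ σ : E ≃ₐ[F] E, map ℓ (σ : E →+* E) (n + 1) α :=
    Equiv.sum_comp (Equiv.inv (E ≃ₐ[F] E)) fun σ => map ℓ (σ : E →+* E) (n + 1) α
  rw [Finset.sum_congr rfl fun σ _ => key σ, ← map_sum, ← map_sum, hsum,
    ← h.incl_transfer, hα, incl_mul_eq_zero_of_root h.prime.ne_zero hβ, map_zero, map_zero]

variable {K M : Type u} [Field K] [Field M] [Algebra F K]
  [Algebra E M] [Algebra K M] [Algebra F M] [IsScalarTower F E M] [IsScalarTower F K M]

/-- This shows that K and E meet in F inside M: an element k outside F generates K, so b = p(k), and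
p(e) would be an ℓ-th root of a in E. -/
theorem mem_range_of_mem_range (hK : IsBassTate ℓ F K) {a : F} {b : K}
    (hb : b ^ ℓ = algebraMap F K a) (hroot : ∀ e : E, e ^ ℓ ≠ algebraMap F E a) {k : K} {e : E}
    (hke : algebraMap K M k = algebraMap E M e) : k ∈ (algebraMap F K).range := by
  have := hK.finiteDimensional
  by_contra hk
  obtain ⟨p, -, hp⟩ := exists_degree_lt_aeval
    (natDegree_minpoly_of_prime (hK.finrank_eq ▸ hK.prime) hk) b
  refine hroot (aeval e p) ((algebraMap E M).injective ?_)
  rw [map_pow, ← aeval_algebraMap_apply, ← hke, aeval_algebraMap_apply, hp, ← map_pow, hb,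
    ← IsScalarTower.algebraMap_apply, ← IsScalarTower.algebraMap_apply]

/-- By normality σ restricts to E, and norms are compatible with the pair of automorphisms. Hence
Galois differences over K transfer to Galois differences over F. -/
theorem transfer_map_algEquiv [Normal F E] (hME : IsBassTate ℓ E M) (σ : M ≃ₐ[K] M)
    (x : MilnorKMod ℓ M (n + 1)) :
    transfer ℓ E M (n + 1) (map ℓ (σ : M →+* M) (n + 1) x) =
      map ℓ (((σ.restrictScalars F).restrictNormal E : E ≃ₐ[F] E) : E →+* E) (n + 1)
        (transfer ℓ E M (n + 1) x) := by
  have hcomm := AlgEquiv.restrictNormal_commutes (σ.restrictScalars F) E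
  refine hME.transfer_map hME (fun c => (hcomm c).symm) (fun b => ?_) x
  have := Algebra.norm_eq_of_equiv_equiv
    (((σ.restrictScalars F).restrictNormal E : E ≃ₐ[F] E) : E ≃+* E) (σ : M ≃+* M)
    (RingHom.ext hcomm) b
  rw [this]
  exact (RingEquiv.apply_symm_apply _ _).symm

/-- The unit u = 1 - b lies in K and has norm c from M to E, so {c} α is the transfer of {u} α from
M. Over M, α has transfer {a} x = ℓ{b} x = 0 to K, so exactness for M/K replaces it by some β from
K. The transfer of {u} β from M to E is the image of its transfer from K to F, which vanishes in the
cokernel. -/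
theorem toCoker_mul_eq_zero_of_root_notMem [Normal F E]
    (hE : IsBassTate ℓ F E) (hK : IsBassTate ℓ F K) (hME : IsBassTate ℓ E M)
    (hMK : IsBassTate ℓ K M) (hex : CoinvExact ℓ K M (n + 1))
    {a c : Fˣ} (hac : (c : F) + a = 1)
    (haE : Irreducible (X ^ ℓ - C (algebraMap F E a))) {b : K} (hb : b ^ ℓ = algebraMap F K a)
    {x : MilnorKMod ℓ F n} {α : MilnorKMod ℓ E (n + 1)}
    (hα : transfer ℓ F E (n + 1) α = mul a x) :
    toCoker F E (n + 2) (mul (Units.map (algebraMap F E : F →* E) c) α) = 0 := by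
  have := hE.finiteDimensional
  have := hK.finiteDimensional
  have := hME.finiteDimensional
  have := hMK.finiteDimensional
  have hroot : ∀ e : E, e ^ ℓ ≠ algebraMap F E a :=
    pow_ne_of_irreducible_X_pow_sub_C haE dvd_rfl hE.prime.ne_one
  have htower : ∀ y : F, algebraMap K M (algebraMap F K y) = algebraMap E M (algebraMap F E y) :=
    fun y => by rw [← IsScalarTower.algebraMap_apply, ← IsScalarTower.algebraMap_apply]
  have hNE := norm_algebraMap_of_disjoint (F := F) (E := E) (K := K) (M := M)
    (hE.finrank_eq ▸ hE.prime) (hMK.finrank_eq.trans hE.finrank_eq.symm) fun e ⟨k, hk⟩ => by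
      obtain ⟨y, rfl⟩ := mem_range_of_mem_range hK hb hroot hk
      exact ⟨y, (algebraMap E M).injective (by rw [← htower, hk])⟩
  have hNK := norm_algebraMap_of_disjoint (F := F) (E := K) (K := E) (M := M)
    (hK.finrank_eq ▸ hK.prime) (hME.finrank_eq.trans hK.finrank_eq.symm)
    fun k ⟨e, he⟩ => mem_range_of_mem_range hK hb hroot he.symm
  have hbM : algebraMap K M b ^ ℓ = algebraMap E M (algebraMap F E a) := by
    rw [← map_pow, hb, htower]
  obtain ⟨u, hu, huN⟩ := exists_unit_norm_one_sub (E := M) hME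
    (a := Units.map (algebraMap F E : F →* E) a) (c := Units.map (algebraMap F E : F →* E) c)
    (by
      simp only [Units.coe_map, MonoidHom.coe_coe]
      rw [← map_add, hac, map_one]) haE hbM
  have hb1 : 1 - b ≠ 0 := fun h0 => u.ne_zero (by rw [hu, ← map_one (algebraMap K M), ← map_sub,
    h0, map_zero])
  have huK : u = Units.map (algebraMap K M : K →* M) (Units.mk0 _ hb1) := by
    ext
    simp [hu]
  have htr : transfer ℓ K M (n + 1) (incl ℓ E M (n + 1) α) = 0 := by
    rw [incl, hE.transfer_map hMK (φ := algebraMap F K) (fun y => (htower y).symm) hNE, hα]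
    exact incl_mul_eq_zero_of_root hE.prime.ne_zero hb x
  obtain ⟨β, hβ⟩ := hex.exists_sub_incl_mem_ker htr
  have h := map_eq_zero_of_mem_ker
    ((toCoker F E (n + 2)).comp ((transfer ℓ E M (n + 2)).comp (mul u))) (fun σ z => ?_) hβ
  · rw [map_sub, sub_eq_zero] at h
    simp only [AddMonoidHom.comp_apply] at h
    rw [hME.transfer_mul_incl, huN] at h
    rw [h, huK, ← incl_mul, incl, hK.transfer_map hME (φ := algebraMap F E) htower hNK]
    exact toCoker_incl _
  · simp only [AddMonoidHom.comp_apply]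
    -- Since u comes from K, multiplication by {u} commutes with σ.
    have hσ : u = Units.map ((σ : M →+* M) : M →* M) u := by
      rw [huK]
      ext
      simp
    conv_lhs => rw [hσ]
    rw [← map_mul_apply, transfer_map_algEquiv (F := F) hME, toCoker_map]

end steinberg

/-- The fields `F(b)` and `E(b)`, where `b ^ ℓ = a` and `a` has no `ℓ`-th root in `E`. -/
theorem exists_adjoin_root {ℓ : ℕ} (hℓ : ℓ.Prime) {F E : Type u} [Field F] [Field E] [Algebra F E]
    [FiniteDimensional F E] {a : F} (haF : Irreducible (X ^ ℓ - C a))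
    (haE : Irreducible (X ^ ℓ - C (algebraMap F E a))) :
    ∃ (K M : Type u) (_ : Field K) (_ : Field M) (_ : Algebra F K) (_ : Algebra E M)
      (_ : Algebra K M) (_ : Algebra F M) (_ : IsScalarTower F E M) (_ : IsScalarTower F K M),
      Module.finrank F K = ℓ ∧ Module.finrank E M = ℓ ∧
        Module.finrank K M = Module.finrank F E ∧ ∃ b : K, b ^ ℓ = algebraMap F K a := by
  have : Fact (Irreducible (X ^ ℓ - C a)) := ⟨haF⟩
  have : Fact (Irreducible (X ^ ℓ - C (algebraMap F E a))) := ⟨haE⟩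
  let K := AdjoinRoot (X ^ ℓ - C a)
  let M := AdjoinRoot (X ^ ℓ - C (algebraMap F E a))
  let φ : K →ₐ[F] M := AdjoinRoot.liftAlgHom _ (Algebra.ofId F M)
    (AdjoinRoot.root (X ^ ℓ - C (algebraMap F E a))) (by
      rw [eval₂_sub, eval₂_pow, eval₂_X, eval₂_C, root_X_pow_sub_C_pow, sub_eq_zero]
      exact (IsScalarTower.algebraMap_apply F E M a).symm)
  let _ : Algebra K M := φ.toRingHom.toAlgebra
  have hK : Module.finrank F K = ℓ := by
    rw [(AdjoinRoot.powerBasis haF.ne_zero).finrank, AdjoinRoot.powerBasis_dim,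
      natDegree_X_pow_sub_C]
  have hM : Module.finrank E M = ℓ := by
    rw [(AdjoinRoot.powerBasis haE.ne_zero).finrank, AdjoinRoot.powerBasis_dim,
      natDegree_X_pow_sub_C]
  have htower : IsScalarTower F K M := IsScalarTower.of_algebraMap_eq fun y => (φ.commutes y).symm
  refine ⟨K, M, inferInstance, inferInstance, inferInstance, inferInstance, inferInstance,
    inferInstance, inferInstance, htower, hK, hM, ?_, AdjoinRoot.root _, root_X_pow_sub_C_pow _ _⟩
  -- Compare both towers from F to M; no separate disjointness argument is needed for the degree of
  -- M over K.
  have h1 := Module.finrank_mul_finrank F K M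
  rw [← Module.finrank_mul_finrank F E M, hK, hM, mul_comm] at h1
  exact Nat.eq_of_mul_eq_mul_right hℓ.pos h1

/-- Exactness of `kₙ(K) → kₙ(L)_Σ → kₙ(K)` for all finite `K / F` and `[L : K] = ℓ` implies
exactness for `E / F` in degree `n + 1`, if the transfer `kₙ(E) → kₙ(F)` is surjective. -/
theorem coinvExact_succ (ℓ : ℕ) (hℓ : ℓ.Prime) (n : ℕ) (hn : 1 ≤ n)
    (F : Type u) [Field F] (hchar : (ℓ : F) ≠ 0) (hF : NoPrimeToExtensions ℓ F)
    (hexact : ∀ (K L : Type u) [Field K] [Field L] [Algebra F K] [FiniteDimensional F K]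
      [Algebra K L], Module.finrank K L = ℓ → MilnorKMod.CoinvExact ℓ K L n)
    (E : Type u) [Field E] [Algebra F E] (hE : Module.finrank F E = ℓ)
    (hsurj : Function.Surjective (MilnorKMod.transfer ℓ F E n)) :
    MilnorKMod.CoinvExact ℓ F E (n + 1) := by
  -- The shift puts both transfers in positive degree, where the norm formula is available.
  obtain ⟨n, rfl⟩ := Nat.exists_eq_add_of_le' hn
  have hEF : IsBassTate ℓ F E := ⟨hℓ, hE, hF.splits hchar hℓ⟩
  have hfin := hEF.finiteDimensional
  have hgal := hF.isGalois hchar hℓ hE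
  have hexF : CoinvExact ℓ F E (n + 1) := hexact F E hE
  -- The class of `{c} α` for an element `α` with prescribed transfer.
  let i : Fˣ →* Eˣ := Units.map (algebraMap F E : F →* E)
  let G : Fˣ → MilnorKMod ℓ F (n + 1) → Coinv ℓ F E (n + 2) ⧸ (inclCoinv ℓ F E (n + 2)).range :=
    fun c x => toCoker F E (n + 2) (mul (i c) (Function.surjInv hsurj x))
  have hG : ∀ c α, G c (transfer ℓ F E (n + 1) α) = toCoker F E (n + 2) (mul (i c) α) :=
    fun c α => by
      rw [← sub_eq_zero, ← map_sub, ← map_sub]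
      exact toCoker_mul_eq_zero hexF c
        (by rw [map_sub, Function.surjInv_eq hsurj, sub_self])
  have hGadd : ∀ c x y, G c (x + y) = G c x + G c y := fun c x y => by
    obtain ⟨α, rfl⟩ := hsurj x
    obtain ⟨β, rfl⟩ := hsurj y
    rw [← map_add, hG, hG, hG, map_add, map_add]
  have hGzero : ∀ c, G c 0 = 0 := fun c => by
    rw [← map_zero (transfer ℓ F E (n + 1)), hG, map_zero, map_zero]
  have hGmul : ∀ c d x, G (c * d) x = G c x + G d x := fun c d x => by
    simp only [G, map_mul, mul_mul, map_add]
  -- Three cases: a is an ℓ-th power in F, only in E, or in neither.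
  have hGst : ∀ c a : Fˣ, (c : F) + a = 1 → ∀ x, G c (mul a x) = 0 := fun c a hca x => by
    by_cases haF : ∃ b : F, b ^ ℓ = a
    · obtain ⟨b, hb⟩ := haF
      have hb0 : b ≠ 0 := by
        rintro rfl
        rw [zero_pow hℓ.ne_zero] at hb
        exact a.ne_zero hb.symm
      obtain rfl : a = Units.mk0 b hb0 ^ ℓ := Units.ext (by simp [hb])
      rw [mul_unit_pow, nsmul_eq_zero, hGzero]
    · have haF' : Irreducible (X ^ ℓ - C (a : F)) :=
        X_pow_sub_C_irreducible_of_prime hℓ fun b hb => haF ⟨b, hb⟩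
      obtain ⟨α, hα⟩ := hsurj (mul a x)
      rw [← hα, hG]
      by_cases haE : ∃ β : E, β ^ ℓ = algebraMap F E a
      · obtain ⟨β, hβ⟩ := haE
        exact toCoker_mul_eq_zero_of_root_mem hEF hca haF' hβ hα
      · have haE' : Irreducible (X ^ ℓ - C (algebraMap F E a)) :=
          X_pow_sub_C_irreducible_of_prime hℓ fun b hb => haE ⟨b, hb⟩
        obtain ⟨K, M, _, _, _, _, _, _, _, _, hFK, hEM, hKM, b, hb⟩ :=
          exists_adjoin_root hℓ haF' haE'
        have hK : IsBassTate ℓ F K := ⟨hℓ, hFK, hF.splits hchar hℓ⟩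
        have := hK.finiteDimensional
        exact toCoker_mul_eq_zero_of_root_notMem hEF hK ⟨hℓ, hEM, hF.splits hchar hℓ⟩
          ⟨hℓ, hKM.trans hE, hF.splits hchar hℓ⟩ (hexact K M (hKM.trans hE)) hca haE' hb hα
  let f : MilnorKMod ℓ F (n + 2) →+ Coinv ℓ F E (n + 2) ⧸ (inclCoinv ℓ F E (n + 2)).range :=
    lift ℓ (fun a => G (a 0) (symbol ℓ (Fin.tail a)))
      (fun a j x y => by
        refine Fin.cases ?_ (fun j => ?_) j
        · simp only [Fin.tail_update_zero, Function.update_self, hGmul]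
        · simp only [Fin.tail_update_succ, symbol_update_mul, hGadd,
            Function.update_of_ne (Fin.succ_ne_zero j).symm])
      (fun a j k hjk => by
        obtain ⟨k, rfl⟩ : ∃ k' : Fin (n + 1), k = k'.succ :=
          ⟨k.pred (by rintro rfl; simp at hjk), by simp⟩
        refine Fin.cases (fun hjk h => ?_) (fun j hjk h => ?_) j hjk
        · obtain rfl : k = 0 := by
            ext
            simpa using hjk
          rw [symbol_eq_mul (Fin.tail a)]
          exact hGst _ _ h _
        · rw [symbol_eq_zero (Fin.tail a) j k (by simpa using hjk) h, hGzero])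
      nsmul_coker_eq_zero
  have hf : ∀ c x, f (mul c x) = G c x := fun c x => by
    have : f.comp (mul c) = AddMonoidHom.mk' (G c) (hGadd c) := MilnorKMod.hom_ext fun a => by
      rw [AddMonoidHom.comp_apply, mul_symbol]
      exact lift_symbol _ _ _ _ _ _
    exact DFunLike.congr_fun this x
  -- On a generator {b, a₀, …} with all aᵢ in F, swap b and a₀, at the cost of a sign on both sides.
  -- Then the transfer is -{a₀} tr{b, a₁, …}, and {b, a₁, …} serves as the element α in the
  -- definition of f.
  have hftr : f.comp (transfer ℓ F E (n + 2)) = toCoker F E (n + 2) := hEF.hom_ext fun b y => by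
    have : (f.comp (transfer ℓ F E (n + 2))).comp ((mul b).comp (incl ℓ F E (n + 1))) =
        (toCoker F E (n + 2)).comp ((mul b).comp (incl ℓ F E (n + 1))) :=
      MilnorKMod.hom_ext fun a => by
        simp only [AddMonoidHom.comp_apply]
        rw [symbol_eq_mul, hEF.transfer_mul_incl, mul_comm_neg, map_neg, hf,
          ← hEF.transfer_mul_incl, hG, incl_mul, mul_comm_neg b, map_neg]
    exact DFunLike.congr_fun this y
  intro y
  obtain ⟨x, rfl⟩ := Representation.Coinvariants.mk_surjective _ y
  rw [transferCoinv_mk]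
  constructor
  · intro hx
    refine toCoker_eq_zero.1 ?_
    rw [← hftr, AddMonoidHom.comp_apply, hx, map_zero]
  · rintro ⟨z, hz⟩
    rw [← transferCoinv_mk, ← hz]
    exact hEF.transfer_incl z

end MilnorKMod

end

theorem lemma3 (ℓ : ℕ) (hℓ : ℓ.Prime) (n : ℕ) (hn : 1 ≤ n)
    (F : Type u) [Field F] (hchar : (ℓ : F) ≠ 0) (hF : NoPrimeToExtensions ℓ F)
    (hexact : ∀ (K L : Type u) [Field K] [Field L] [Algebra F K] [FiniteDimensional F K]
      [Algebra K L], Module.finrank K L = ℓ → MilnorKMod.CoinvExact ℓ K L n)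
    (E : Type u) [Field E] [Algebra F E] (hE : Module.finrank F E = ℓ)
    (hsurj : Function.Surjective (MilnorKMod.transfer ℓ F E n)) :
    MilnorKMod.CoinvExact ℓ F E (n + 1) :=
  MilnorKMod.coinvExact_succ ℓ hℓ n hn F hchar hF hexact E hE hsurj
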